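/- Let $P_0,P_1,P_2,P_3\in\mathbb R^3$ be affinely independent, let $f_i(X)=\tfrac12(X+P_i)$, and let $\mathfrak{ST}$ be the Sierpiński tetrahedron, i.e. the unique nonempty compact set with $\mathfrak{ST}=\bigcup_{i=0}^3 f_i(\mathfrak{ST})$. Let $\mu$ be the self-similar probability measure on $\mathfrak{ST}$ with $\mu=\tfrac14\sum_{i=0}^3\mu\circ f_i^{-1}$. Put $V_0=\{P_0,\dots,P_3\}$, $V_{m+1}=\bigcup_i f_i(V_m)$ and $V_\star=\bigcup_m V_m$. Write $X\sim_m Y$ if $X\neq Y$ and $X,Y\in f_{i_1}\circ\cdots\circ f_{i_m}(V_0)$ for some word $(i_1,\dots,i_m)\in\{0,1,2,3\}^m$. With $r=\tfrac23$, let $$\Delta_m u(X)=\sum_{Y\in V_m,\,Y\sim_m X}(u(Y)-u(X)),\qquad \mathcal E_m(u,v)=r^{-m}\sum_{\{X,Y\}:\,X\sim_m Y}(u(X)-u(Y))(v(X)-v(Y)),$$ and $\mathcal E(u,v)=\lim_{m\to\infty}\mathcal E_m(u,v)$. Let $\operatorname{dom}\mathcal E$ be the set of real continuous functions $u$ on $\mathfrak{ST}$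 with $\mathcal E(u,u)<\infty$, and $\operatorname{dom}_0\mathcal E$ the set of those that vanish on $V_0$. Let $\operatorname{dom}\Delta$ be the set of $u\in\operatorname{dom}\mathcal E$ for which there is a continuous function $\Delta u$ on $\mathfrak{ST}$ with $\mathcal E(u,v)=-\int_{\mathfrak{ST}} v\,\Delta u\,d\mu$ for all $v\in\operatorname{dom}_0\mathcal E$; $u$ is harmonic if $u\in\operatorname{dom}\Delta$ and $\Delta u=0$. For $m\ge 0$ and $X\in V_m\setminus V_0$ there is a continuous function $\psi_X^m$ on $\mathfrak{ST}$ such that $\psi_X^m\circ f_{i_1}\circ\cdots\circ f_{i_m}$ is harmonic for every word $(i_1,\dots,i_m)$, $\psi_X^m(X)=1$, and $\psi_X^m(Y)=0$ for $Y\in V_m\setminus\{X\}$. For any such functions and any continuous $u$ on $\mathfrak{ST}$, put $$f_m(X)=r^{-m}\Bigl(\int_{\mathfrak{ST}}\psi_X^m\,d\mu\Bigr)^{-1}\Delta_m u(X),\qquad X\in V_m\setminus V_0 .$$ 1. If $u\in\operatorname{dom}\Delta$, then $(f_m)$ converges uniformly to $\Delta u$ on $V_\star\setminus V_0$, in the sense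 that $\sup_{X\in V_m\setminus V_0}|f_m(X)-\Delta u(X)|\to0$ as $m\to\infty$. Moreover, for every $X\in V_\star\setminus V_0$, $\Delta u(X)=2\lim_{m\to\infty}6^m\Delta_m u(X)$. 2. Conversely, if $u$ is continuous on $\mathfrak{ST}$ and $(f_m)$ converges uniformly on $V_\star\setminus V_0$, in the same sense, to a function that is continuous on $\mathfrak{ST}$, i.e. there is a continuous $g:\mathfrak{ST}\to\mathbb R$ with $\sup_{X\in V_m\setminus V_0}|f_m(X)-g(X)|\to0$, then $u\in\operatorname{dom}\Delta$. -/

import Mathlib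

open MeasureTheory Filter Topology

namespace SierpinskiTetrahedron

/-- Euclidean three-space. -/
abbrev E3 : Type := EuclideanSpace ℝ (Fin 3)

/-- The contraction `f_i` of ratio `1/2` with fixed point `P_i`. -/
noncomputable def f (P : Fin 4 → E3) (i : Fin 4) (X : E3) : E3 :=
  (2 : ℝ)⁻¹ • (X + P i)

/-- The composition `f_W = f_{W_1} ∘ ⋯ ∘ f_{W_m}` along a word `W`. -/
noncomputable def fw (P : Fin 4 → E3) : List (Fin 4) → E3 → E3
  | [] => id
  | i :: w => f P i ∘ fw P w

/-- The point with address `ω`, i.e. the limit of `f_{ω 0} ∘ ⋯ ∘ f_{ω n}`. -/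
noncomputable def code (P : Fin 4 → E3) (ω : ℕ → Fin 4) : E3 :=
  ∑' n, ((2 : ℝ)⁻¹) ^ (n + 1) • P (ω n)

/-- The Sierpinski tetrahedron with corners `P`, as the set of all points that have an address.
It is the nonempty compact set fixed by the iterated function system: see `ST_nonempty`,
`isCompact_ST` and `ST_eq` below. -/
def ST (P : Fin 4 → E3) : Set E3 := Set.range (code P)

/-- The uniform Bernoulli measure on the space of addresses. -/
noncomputable def bernoulli : Measure (ℕ → Fin 4) :=
  Measure.infinitePi fun _ : ℕ => (PMF.uniformOfFintype (Fin 4)).toMeasure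

/-- The self-similar probability measure with equal weights `1/4`: see `mu_selfSimilar` below. -/
noncomputable def mu (P : Fin 4 → E3) : Measure E3 := bernoulli.map (code P)

open Classical in
/-- The vertex set `V_m`. -/
noncomputable def V (P : Fin 4 → E3) : ℕ → Finset E3
  | 0 => Finset.univ.image P
  | m + 1 => Finset.univ.biUnion fun i => (V P m).image (f P i)

/-- The edge relation of level `m`: distinct vertices of a common cell `f_W V_0`, `|W| = m`. -/
def Adj (P : Fin 4 → E3) (m : ℕ) (X Y : E3) : Prop :=
  X ≠ Y ∧ ∃ w : List (Fin 4), w.length = m ∧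
    (∃ i, X = fw P w (P i)) ∧ ∃ j, Y = fw P w (P j)

open Classical in
/-- The graph Laplacian `Δ_m u (X)`, the sum of `u(Y) - u(X)` over the neighbours `Y` of `X`
in the graph of level `m`. -/
noncomputable def graphLaplacian (P : Fin 4 → E3) (m : ℕ) (u : E3 → ℝ) (X : E3) : ℝ :=
  ∑ Y ∈ (V P m).filter (Adj P m X), (u Y - u X)

/-- The renormalization constant `r = 2/3` of the energies. -/
noncomputable def r : ℝ := 2 / 3

open Classical in
/-- The normalized energy `r^{-m} ∑ (u(X) - u(Y)) (v(X) - v(Y))`, the sum being over the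
(unoriented) edges of level `m`; summing over ordered pairs counts every edge twice. -/
noncomputable def energy (P : Fin 4 → E3) (m : ℕ) (u v : E3 → ℝ) : ℝ :=
  (r ^ m)⁻¹ * ((1 / 2) *
    ∑ X ∈ V P m, ∑ Y ∈ (V P m).filter (Adj P m X), (u X - u Y) * (v X - v Y))

/-- The domain of the Dirichlet form: continuous functions on the tetrahedron (values elsewhere
are irrelevant) whose normalized energies have a finite limit. -/
def domE (P : Fin 4 → E3) : Set (E3 → ℝ) :=
  {u | ContinuousOn u (ST P) ∧ ∃ L : ℝ, Tendsto (fun m => energy P m u u) atTop (𝓝 L)}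

/-- The functions of `domE` that vanish on `V_0`. -/
def domE₀ (P : Fin 4 → E3) : Set (E3 → ℝ) :=
  {v | v ∈ domE P ∧ ∀ X ∈ V P 0, v X = 0}

/-- `g` is the Laplacian of `u`: `u` is in the domain of the form, `g` is continuous on the
tetrahedron, and `ℰ(u, v) = lim_m ℰ_m(u, v) = - ∫ v g dμ` for all `v` in `domE₀`. -/
def IsLaplacian (P : Fin 4 → E3) (u g : E3 → ℝ) : Prop :=
  u ∈ domE P ∧ ContinuousOn g (ST P) ∧
    ∀ v ∈ domE₀ P,
      Tendsto (fun m => energy P m u v) atTop (𝓝 (-∫ x in ST P, v x * g x ∂(mu P)))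

/-- The domain `dom Δ` of the Laplacian. -/
def domLaplacian (P : Fin 4 → E3) : Set (E3 → ℝ) :=
  {u | ∃ g, IsLaplacian P u g}

/-- A harmonic function is a function of `dom Δ` with Laplacian zero. -/
def IsHarmonic (P : Fin 4 → E3) (u : E3 → ℝ) : Prop := IsLaplacian P u fun _ => 0

/-- `ψ` is the spline `ψ_X^m` of level `m`: it is continuous, harmonic on every cell of level `m`,
and its values on `V_m` are one at `X` and zero elsewhere. -/
def IsSpline (P : Fin 4 → E3) (m : ℕ) (X : E3) (ψ : E3 → ℝ) : Prop :=
  ContinuousOn ψ (ST P) ∧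
    (∀ w : List (Fin 4), w.length = m → IsHarmonic P (ψ ∘ fw P w)) ∧
    ψ X = 1 ∧ ∀ Y ∈ V P m, Y ≠ X → ψ Y = 0

/-- The renormalized graph Laplacian `r^{-m} (∫ ψ_X^m dμ)⁻¹ Δ_m u (X)`. -/
noncomputable def renormLaplacian (P : Fin 4 → E3) (ψ : ℕ → E3 → E3 → ℝ) (u : E3 → ℝ)
    (m : ℕ) (X : E3) : ℝ :=
  (r ^ m)⁻¹ * (∫ x in ST P, ψ m X x ∂(mu P))⁻¹ * graphLaplacian P m u X

/-- Uniform convergence of functions `F m`, the `m`-th being defined on `V_m \ V_0`, to a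
function `g` on `V_* \ V_0`. -/
def UniformLimit (P : Fin 4 → E3) (F : ℕ → E3 → ℝ) (g : E3 → ℝ) : Prop :=
  ∀ ε > 0, ∃ N, ∀ m ≥ N, ∀ X ∈ V P m, X ∉ V P 0 → |F m X - g X| < ε

/-! The set `ST` and the measure `mu` are the self-similar ones. -/

lemma summable_code (P : Fin 4 → E3) (ω : ℕ → Fin 4) :
    Summable fun n => ((2 : ℝ)⁻¹) ^ (n + 1) • P (ω n) := by
  have h : Summable fun n : ℕ => ((2 : ℝ)⁻¹) ^ (n + 1) * ∑ i, ‖P i‖ :=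
    ((summable_nat_add_iff 1).2
      (summable_geometric_of_lt_one (by norm_num) (by norm_num : (2 : ℝ)⁻¹ < 1))).mul_right _
  refine Summable.of_norm_bounded h fun n => ?_
  rw [norm_smul, Real.norm_of_nonneg (by positivity)]
  gcongr
  exact Finset.single_le_sum (f := fun i => ‖P i‖) (fun i _ => norm_nonneg _)
    (Finset.mem_univ (ω n))

lemma continuous_code (P : Fin 4 → E3) : Continuous (code P) := by
  have h : Summable fun n : ℕ => ((2 : ℝ)⁻¹) ^ (n + 1) * ∑ i, ‖P i‖ :=
    ((summable_nat_add_iff 1).2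
      (summable_geometric_of_lt_one (by norm_num) (by norm_num : (2 : ℝ)⁻¹ < 1))).mul_right _
  refine continuous_tsum (fun n => ?_) h fun n ω => ?_
  · have hP : Continuous P := continuous_of_discreteTopology
    have hn : Continuous fun ω : ℕ → Fin 4 => P (ω n) := hP.comp (continuous_apply n)
    exact hn.const_smul (((2 : ℝ)⁻¹) ^ (n + 1))
  · rw [norm_smul, Real.norm_of_nonneg (by positivity)]
    gcongr
    exact Finset.single_le_sum (f := fun i => ‖P i‖) (fun i _ => norm_nonneg _)
      (Finset.mem_univ (ω n))

/-- Prepending a letter to an address. -/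
def cons (i : Fin 4) (ω : ℕ → Fin 4) : ℕ → Fin 4
  | 0 => i
  | n + 1 => ω n

lemma code_cons (P : Fin 4 → E3) (i : Fin 4) (ω : ℕ → Fin 4) :
    code P (cons i ω) = f P i (code P ω) := by
  unfold code f
  rw [(summable_code P (cons i ω)).tsum_eq_zero_add, smul_add, ← (summable_code P ω).tsum_const_smul,
    add_comm]
  simp only [cons, smul_smul, zero_add, pow_one]
  congr 1
  refine tsum_congr fun n => ?_
  rw [← pow_succ']

lemma ST_nonempty (P : Fin 4 → E3) : (ST P).Nonempty := Set.range_nonempty _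

lemma isCompact_ST (P : Fin 4 → E3) : IsCompact (ST P) := isCompact_range (continuous_code P)

lemma ST_eq (P : Fin 4 → E3) : ST P = ⋃ i, f P i '' ST P := by
  ext x
  simp only [ST, Set.mem_iUnion, Set.mem_image, Set.mem_range, exists_exists_eq_and]
  constructor
  · rintro ⟨ω, rfl⟩
    refine ⟨ω 0, fun n => ω (n + 1), ?_⟩
    rw [← code_cons]
    congr 1
    funext n
    cases n <;> rfl
  · rintro ⟨i, ω, rfl⟩
    exact ⟨cons i ω, code_cons P i ω⟩

lemma bernoulli_eq : bernoulli = (4 : ENNReal)⁻¹ • ∑ i, bernoulli.map (cons i) := by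
  have hc : ∀ i, Measurable (cons i) := fun i => measurable_pi_lambda _ fun n => by
    cases n
    · exact measurable_const
    · exact measurable_pi_apply _
  symm
  refine Measure.eq_infinitePi _ fun s t ht => ?_
  set p : Measure (Fin 4) := (PMF.uniformOfFintype (Fin 4)).toMeasure with hp
  have key : ∀ i, bernoulli.map (cons i) (Set.pi s t) =
      (if 0 ∈ s then (t 0).indicator 1 i else 1) *
        ∏ n ∈ s.erase 0, p (t n) := by
    intro i
    rw [Measure.map_apply (hc i) (MeasurableSet.pi s.countable_toSet fun n _ => ht n)]
    obtain ⟨T, hT, hs⟩ : ∃ T : Finset ℕ, (∀ n, n ∈ T ↔ n + 1 ∈ s) ∧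
        s.erase 0 = T.image Nat.succ := by
      have hT : ∀ n, n ∈ (s.erase 0).image Nat.pred ↔ n + 1 ∈ s := by
        intro n
        simp only [Finset.mem_image, Finset.mem_erase]
        constructor
        · rintro ⟨k, ⟨h0, hk⟩, rfl⟩
          rwa [← Nat.succ_eq_add_one, Nat.succ_pred h0]
        · exact fun hn => ⟨n + 1, ⟨by omega, hn⟩, rfl⟩
      refine ⟨_, hT, ?_⟩
      ext n
      rw [Finset.mem_image, Finset.mem_erase]
      constructor
      · rintro ⟨h0, hn⟩
        exact ⟨n.pred, (hT _).2 (by rwa [← Nat.succ_eq_add_one, Nat.succ_pred h0]),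
          Nat.succ_pred h0⟩
      · rintro ⟨k, hk, rfl⟩
        exact ⟨Nat.succ_ne_zero k, (hT k).1 hk⟩
    have h1 : ∀ ω, cons i ω ∈ Set.pi s t ↔
        (0 ∈ s → i ∈ t 0) ∧ ω ∈ Set.pi T fun n => t (n + 1) := by
      intro ω
      constructor
      · exact fun h => ⟨fun h0 => h 0 h0, fun n hn => h (n + 1) ((hT n).1 hn)⟩
      · rintro ⟨h0, h⟩ n hn
        cases n with
        | zero => exact h0 hn
        | succ n => exact h n ((hT n).2 hn)
    have hB : bernoulli (Set.pi T fun n => t (n + 1)) = ∏ n ∈ s.erase 0, p (t n) := by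
      rw [bernoulli, Measure.infinitePi_pi _ fun n _ => ht (n + 1), hs,
        Finset.prod_image fun a _ b _ h => Nat.succ_injective h]
    by_cases hi : 0 ∈ s → i ∈ t 0
    · have hpre : cons i ⁻¹' (Set.pi s t) = Set.pi T fun n => t (n + 1) := by
        ext ω
        rw [Set.mem_preimage, h1]
        exact and_iff_right hi
      rw [hpre, hB]
      by_cases h0 : 0 ∈ s
      · simp [h0, hi h0]
      · simp [h0]
    · have hpre : cons i ⁻¹' (Set.pi s t) = ∅ := by
        ext ω
        rw [Set.mem_preimage, h1]
        exact iff_of_false (fun h => hi h.1) id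
      rw [hpre]
      rw [Classical.not_imp] at hi
      simp [hi.1, hi.2]
  rw [Measure.smul_apply, Measure.finsetSum_apply, Finset.sum_congr rfl fun i _ => key i,
    ← Finset.sum_mul, smul_eq_mul, ← mul_assoc]
  by_cases h0 : 0 ∈ s
  · rw [← Finset.mul_prod_erase s _ h0]
    congr 1
    simp only [h0, if_true]
    rw [hp, PMF.toMeasure_apply_fintype, Finset.mul_sum]
    refine Finset.sum_congr rfl fun i _ => ?_
    by_cases hi : i ∈ t 0 <;> simp [hi]
  · rw [Finset.erase_eq_of_notMem h0]
    simp only [h0, if_false, Finset.sum_const, Finset.card_univ, Fintype.card_fin, nsmul_eq_mul,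
      mul_one]
    rw [show ((4 : ℕ) : ENNReal) = 4 from rfl, ENNReal.inv_mul_cancel (by norm_num) (by norm_num),
      one_mul]

lemma mu_selfSimilar (P : Fin 4 → E3) : mu P = (4 : ENNReal)⁻¹ • ∑ i, (mu P).map (f P i) := by
  have hc : ∀ i, Measurable (cons i) := fun i => measurable_pi_lambda _ fun n => by
    cases n
    · exact measurable_const
    · exact measurable_pi_apply _
  have hm : Measurable (code P) := (continuous_code P).measurable
  have hf : ∀ i, Measurable (f P i) := fun i => by unfold f; fun_prop
  have h : ∀ i, (mu P).map (f P i) = (bernoulli.map (cons i)).map (code P) := fun i => by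
    rw [mu, Measure.map_map (hf i) hm, Measure.map_map hm (hc i)]
    congr 1
    funext ω
    exact (code_cons P i ω).symm
  simp only [h]
  conv_lhs => rw [mu, bernoulli_eq, Measure.map_smul]
  congr 1
  ext A hA
  simp only [Measure.map_apply hm hA, Measure.finsetSum_apply]

instance (P : Fin 4 → E3) : IsProbabilityMeasure (mu P) := by
  unfold mu bernoulli
  exact Measure.isProbabilityMeasure_map (continuous_code P).aemeasurable

end SierpinskiTetrahedron

namespace SierpinskiTetrahedron

/-! ### Words -/

/-! Everything rests on the identity that, at every level, the energy of a harmonic function against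
any `v` is the form `Q` of their values on `V_0` (`energy_harm`). It follows from the one-step
renormalization identity `sum_Q_M`, which is where `r = 2/3` is used. Applied cell by cell, it shows
that the energy of `u` against a spline `ψ` of level `m` is constant from level `m` on. By the
discrete Green formula `energy_green` that constant is `-r^{-m} Δ_m u(X)`.

Direct part: if `g` is the Laplacian of `u`, then `∫ ψ g = r^{-m} Δ_m u(X)` (`avg_spline_mul`), so
`f_m(X)` is the mean of `g` with weight `ψ`. Since `ψ` is nonnegative and lives on the cells with
corner `X`, uniform continuity of `g` gives uniform convergence. A vertex outside `V_0` is a corner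
of exactly two cells, and the mean of a harmonic function is the mean of its corner values. So `∫ ψ
= 4^{-m}/2`, and the normalizing factor is `2 * 6^m`.

Converse: if `v` vanishes on `V_0`, Green's formula makes the energy of `u` and `v` at level `m`
minus a Riemann sum of `v f_m`, which tends to `-∫ v g` (`tendsto_energy_of_uniformLimit`). Taking
for `v` the function `u` minus the harmonic function with the same boundary values also shows that
`u` has finite energy.

Harmonic functions are built on addresses by iterating the extension rule `M`. They descend to the
tetrahedron because two cells of level one meet only in the images of corners (`vertices_of_f_eq`).
Uniqueness (`eq_harm_of_isHarmonic`) identifies the given splines with the constructed ones. -/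

/-- The words of length `m`. -/
def words : ℕ → Finset (List (Fin 4))
  | 0 => {[]}
  | m + 1 => (Finset.univ ×ˢ words m).map
      ⟨fun p => p.1 :: p.2, fun p q h => by
        obtain ⟨h1, h2⟩ := List.cons_eq_cons.1 h
        exact Prod.ext h1 h2⟩

lemma mem_words {m : ℕ} {w : List (Fin 4)} : w ∈ words m ↔ w.length = m := by
  induction m generalizing w with
  | zero => simp [words]
  | succ m ih =>
    cases w with
    | nil => simp [words]
    | cons i w =>
      simp only [words, Finset.mem_map, Finset.mem_product, Finset.mem_univ, true_and, ih,
        List.length_cons, add_left_inj]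
      constructor
      · rintro ⟨p, hp, h⟩
        exact (List.cons_eq_cons.1 h).2 ▸ hp
      · exact fun h => ⟨(i, w), h, rfl⟩

lemma sum_words_zero (F : List (Fin 4) → ℝ) : ∑ w ∈ words 0, F w = F [] := by simp [words]

lemma sum_words_succ (m : ℕ) (F : List (Fin 4) → ℝ) :
    ∑ w ∈ words (m + 1), F w = ∑ i, ∑ w ∈ words m, F (i :: w) := by
  rw [words, Finset.sum_map, Finset.sum_product]
  rfl

lemma sum_words_add (m k : ℕ) (F : List (Fin 4) → ℝ) :
    ∑ w ∈ words (m + k), F w = ∑ w ∈ words m, ∑ v ∈ words k, F (w ++ v) := by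
  induction m generalizing F with
  | zero => simp [sum_words_zero]
  | succ m ih =>
    rw [Nat.succ_add_eq_add_succ, Nat.add_succ, sum_words_succ, sum_words_succ]
    exact Finset.sum_congr rfl fun i _ => ih _

lemma card_words (m : ℕ) : ((words m).card : ℝ) = 4 ^ m := by
  induction m with
  | zero => simp [words]
  | succ m ih =>
    rw [words, Finset.card_map, Finset.card_product, Nat.cast_mul, ih]
    simp [pow_succ']

/-! ### The maps of the iterated function system -/

variable {P : Fin 4 → E3}

lemma f_injective (i : Fin 4) : Function.Injective (f P i) := fun x y h =>
  add_right_cancel (smul_right_injective E3 (by norm_num : (2 : ℝ)⁻¹ ≠ 0) h)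

lemma f_self (i : Fin 4) : f P i (P i) = P i := by
  rw [f, ← two_smul ℝ (P i), smul_smul]
  norm_num

lemma f_comm (i j : Fin 4) : f P i (P j) = f P j (P i) := by rw [f, f, add_comm]

lemma fw_append (w v : List (Fin 4)) (x : E3) : fw P (w ++ v) x = fw P w (fw P v x) := by
  induction w with
  | nil => rfl
  | cons i w ih => simp only [List.cons_append, fw, Function.comp_apply, ih]

lemma fw_sub (w : List (Fin 4)) (x y : E3) :
    fw P w x - fw P w y = ((2 : ℝ)⁻¹) ^ w.length • (x - y) := by
  induction w with
  | nil => simp [fw]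
  | cons i w ih =>
    simp only [fw, Function.comp_apply, f, ← smul_sub, add_sub_add_right_eq_sub, ih,
      List.length_cons, pow_succ', mul_smul]

lemma fw_injective (w : List (Fin 4)) : Function.Injective (fw P w) := fun x y h => by
  have := fw_sub (P := P) w x y
  rw [h, sub_self, eq_comm, smul_eq_zero_iff_right (by positivity)] at this
  exact sub_eq_zero.1 this

lemma continuous_fw (w : List (Fin 4)) : Continuous (fw P w) := by
  induction w with
  | nil => exact continuous_id
  | cons i w ih =>
    have : Continuous (f P i) := by unfold f; fun_prop
    exact this.comp ih

/-- The address without its first letter. -/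
def shift (ω : ℕ → Fin 4) : ℕ → Fin 4 := fun n => ω (n + 1)

lemma cons_shift (ω : ℕ → Fin 4) : cons (ω 0) (shift ω) = ω := by
  funext n
  cases n <;> rfl

lemma continuous_shift : Continuous shift := continuous_pi fun n => continuous_apply (n + 1)

lemma continuous_cons (i : Fin 4) : Continuous (cons i) := continuous_pi fun n => by
  cases n
  · exact continuous_const
  · exact continuous_apply _

lemma code_eq (ω : ℕ → Fin 4) : code P ω = f P (ω 0) (code P (shift ω)) := by
  rw [← code_cons, cons_shift]

lemma code_const (i : Fin 4) : code P (fun _ => i) = P i := by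
  have h := code_eq (P := P) fun _ => i
  change code P (fun _ => i) = f P i (code P fun _ => i) at h
  set x := code P fun _ => i
  have h2 : (2 : ℝ) • x = x + P i := by
    conv_lhs => rw [h, f, smul_smul]
    norm_num
  rw [two_smul] at h2
  exact add_left_cancel h2

lemma code_mem (ω : ℕ → Fin 4) : code P ω ∈ ST P := ⟨ω, rfl⟩

lemma vertex_mem (i : Fin 4) : P i ∈ ST P := ⟨_, code_const i⟩

lemma f_mem (i : Fin 4) {x : E3} (hx : x ∈ ST P) : f P i x ∈ ST P := by
  obtain ⟨ω, rfl⟩ := hx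
  exact ⟨_, code_cons P i ω⟩

lemma fw_mem (w : List (Fin 4)) {x : E3} (hx : x ∈ ST P) : fw P w x ∈ ST P := by
  induction w with
  | nil => exact hx
  | cons i w ih => exact f_mem i ih

lemma continuousOn_comp_fw {F : E3 → ℝ} (hF : ContinuousOn F (ST P)) (w : List (Fin 4)) :
    ContinuousOn (F ∘ fw P w) (ST P) :=
  hF.comp (continuous_fw w).continuousOn fun _ hx => fw_mem w hx

/-- A function on the tetrahedron is continuous if it is a continuous function of the address. -/
lemma continuousOn_of_code {F : E3 → ℝ} (h : Continuous fun ω => F (code P ω)) :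
    ContinuousOn F (ST P) := by
  rw [continuousOn_iff_continuous_domRestrict]
  have hc : Continuous (Set.rangeFactorization (code P)) :=
    (continuous_code P).subtype_mk _
  -- A continuous surjection from a compact space onto a Hausdorff space is closed, hence a quotient
  -- map.
  have hq : IsQuotientMap (Set.rangeFactorization (code P)) :=
    hc.isClosedMap.isQuotientMap hc Set.rangeFactorization_surjective
  exact hq.continuous_iff.2 h

lemma continuous_comp_code {F : E3 → ℝ} (hF : ContinuousOn F (ST P)) :
    Continuous fun ω => F (code P ω) :=
  hF.comp_continuous (continuous_code P) code_mem

/-! ### Vertices -/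

lemma mem_V_zero {X : E3} : X ∈ V P 0 ↔ ∃ i, P i = X := by simp [V]

lemma mem_V_succ {m : ℕ} {X : E3} : X ∈ V P (m + 1) ↔ ∃ i, ∃ Y ∈ V P m, f P i Y = X := by
  simp [V]

lemma mem_V {m : ℕ} {X : E3} : X ∈ V P m ↔ ∃ w ∈ words m, ∃ i, fw P w (P i) = X := by
  induction m generalizing X with
  | zero => simp [mem_V_zero, words, fw]
  | succ m ih =>
    rw [mem_V_succ]
    constructor
    · rintro ⟨i, Y, hY, rfl⟩
      obtain ⟨w, hw, j, rfl⟩ := ih.1 hY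
      exact ⟨i :: w, by simpa [mem_words] using hw, j, rfl⟩
    · rintro ⟨w, hw, j, rfl⟩
      cases w with
      | nil => simp [mem_words] at hw
      | cons i w => exact ⟨i, _, ih.2 ⟨w, by simpa [mem_words] using hw, j, rfl⟩, rfl⟩

lemma fw_vertex_mem_V {m : ℕ} {w : List (Fin 4)} (hw : w ∈ words m) (i : Fin 4) :
    fw P w (P i) ∈ V P m := mem_V.2 ⟨w, hw, i, rfl⟩

lemma vertex_mem_V (m : ℕ) (i : Fin 4) : P i ∈ V P m := by
  induction m with
  | zero => exact mem_V_zero.2 ⟨i, rfl⟩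
  | succ m ih => exact mem_V_succ.2 ⟨i, _, ih, f_self i⟩

lemma V_zero_subset (m : ℕ) : V P 0 ⊆ V P m := fun X hX => by
  obtain ⟨i, rfl⟩ := mem_V_zero.1 hX
  exact vertex_mem_V m i

lemma V_mono : Monotone (V P) := monotone_nat_of_le_succ fun m X hX => by
  obtain ⟨w, hw, i, rfl⟩ := mem_V.1 hX
  refine mem_V.2 ⟨w ++ [i], by simpa [mem_words] using hw, i, ?_⟩
  rw [fw_append]
  exact congrArg _ (f_self i)

lemma mem_ST_of_mem_V {m : ℕ} {X : E3} (hX : X ∈ V P m) : X ∈ ST P := by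
  obtain ⟨w, -, i, rfl⟩ := mem_V.1 hX
  exact fw_mem w (vertex_mem i)

/-! ### Cells meet in vertices only -/

/-- The barycentric coordinates with respect to the corners. -/
lemma exists_barycentric (hP : AffineIndependent ℝ P) : ∃ l : Fin 4 → E3 → ℝ,
    (∀ j, Continuous (l j)) ∧
    (∀ i j X, l j (f P i X) = (l j X + if i = j then 1 else 0) / 2) ∧
    (∀ X, ∑ j, l j X = 1) ∧ ∀ X Y, (∀ j, l j X = l j Y) → X = Y := by
  have htop : affineSpan ℝ (Set.range P) = ⊤ :=
    hP.affineSpan_eq_top_iff_card_eq_finrank_add_one.2 (by simp)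
  let b : AffineBasis (Fin 4) ℝ E3 := ⟨P, hP, htop⟩
  refine ⟨fun j => b.coord j, fun j => (b.coord j).continuous_of_finiteDimensional,
    fun i j X => ?_, b.sum_coord_apply_eq_one, fun X Y => b.ext_elem⟩
  have h1 : f P i X = midpoint ℝ X (b i) := by
    rw [midpoint_eq_smul_add, invOf_eq_inv]
    rfl
  change b.coord j (f P i X) = (b.coord j X + if i = j then 1 else 0) / 2
  rw [h1, AffineMap.map_midpoint, midpoint_eq_smul_add, b.coord_apply, invOf_eq_inv, smul_eq_mul]
  simp only [eq_comm (a := j)]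
  ring

/-- At a minimum point `y = f_i y'`, the coordinate of `y` is at least half that of `y'`, hence at
least half the minimum; so the minimum is not negative. -/
lemma barycentric_nonneg {l : Fin 4 → E3 → ℝ} (hc : ∀ j, Continuous (l j))
    (hl : ∀ i j X, l j (f P i X) = (l j X + if i = j then 1 else 0) / 2)
    {x : E3} (hx : x ∈ ST P) (j : Fin 4) : 0 ≤ l j x := by
  obtain ⟨y, hy, hmin⟩ := (isCompact_ST P).exists_isMinOn (ST_nonempty P) (hc j).continuousOn
  refine le_trans ?_ (hmin hx)
  obtain ⟨ω, rfl⟩ := hy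
  have h1 : l j (code P ω) ≤ l j (code P (shift ω)) := hmin (code_mem _)
  have h2 := hl (ω 0) j (code P (shift ω))
  rw [← code_eq] at h2
  split_ifs at h2 <;> linarith

/-- Comparing the `i`-th barycentric coordinates gives `l_i y = l_i x + 1 ≥ 1`. The coordinates of
`y` are nonnegative with sum one, so `y` is the corner `P i`; the other half is symmetric. -/
lemma vertices_of_f_eq (hP : AffineIndependent ℝ P) {i j : Fin 4} (hij : i ≠ j) {x y : E3}
    (hx : x ∈ ST P) (hy : y ∈ ST P) (h : f P i x = f P j y) : x = P j ∧ y = P i := by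
  obtain ⟨l, hc, hl, hs, he⟩ := exists_barycentric hP
  have key : ∀ (i j : Fin 4), i ≠ j → ∀ x ∈ ST P, ∀ y ∈ ST P, f P i x = f P j y → y = P i := by
    intro i j hij x hx y hy h
    have hfix : ∀ k, l k (P i) = if i = k then 1 else 0 := fun k => by
      have := hl i k (P i)
      rw [f_self] at this
      linarith
    have h1 := hl i i x
    rw [h, hl j i y, if_pos rfl, if_neg hij.symm] at h1
    have hge : 1 ≤ l i y := by linarith [barycentric_nonneg hc hl hx i]
    have hsum := hs y
    rw [← Finset.add_sum_erase _ _ (Finset.mem_univ i)] at hsum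
    have hnn : ∀ k ∈ Finset.univ.erase i, 0 ≤ l k y := fun k _ => barycentric_nonneg hc hl hy k
    have h0 : ∑ k ∈ Finset.univ.erase i, l k y = 0 :=
      le_antisymm (by linarith) (Finset.sum_nonneg hnn)
    refine he _ _ fun k => ?_
    rw [hfix]
    split_ifs with hk
    · subst hk; linarith
    · exact (Finset.sum_eq_zero_iff_of_nonneg hnn).1 h0 k (by simpa using Ne.symm hk)
  exact ⟨key j i hij.symm y hy x hx h.symm, key i j hij x hx y hy h⟩

lemma eq_const_of_code_eq (hP : AffineIndependent ℝ P) {ω : ℕ → Fin 4} {j : Fin 4}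
    (h : code P ω = P j) : ω = fun _ => j := by
  have key : ∀ ω, code P ω = P j → ω 0 = j ∧ code P (shift ω) = P j := by
    intro ω h
    rw [code_eq, ← f_self (P := P) j] at h
    by_cases h0 : ω 0 = j
    · rw [h0] at h
      exact ⟨h0, f_injective j h⟩
    · exact absurd (hP.injective (vertices_of_f_eq hP h0 (code_mem _) (vertex_mem j) h).2).symm h0
  funext n
  induction n generalizing ω with
  | zero => exact (key ω h).1
  | succ n ih => exact ih (key ω h).2

lemma eq_of_fw_eq (hP : AffineIndependent ℝ P) {w w' : List (Fin 4)}
    (hl : w.length = w'.length) (h : ∀ x, fw P w x = fw P w' x) : w = w' := by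
  induction w generalizing w' with
  | nil => exact (List.length_eq_zero_iff.1 hl.symm).symm
  | cons i w ih =>
    cases w' with
    | nil => simp at hl
    | cons j w' =>
      have hij : i = j := by
        by_contra hij
        have h1 : ∀ k, fw P w (P k) = P j := fun k =>
          (vertices_of_f_eq hP hij (fw_mem w (vertex_mem k)) (fw_mem w' (vertex_mem k)) (h (P k))).1
        exact absurd (hP.injective (fw_injective w ((h1 0).trans (h1 1).symm))) (by decide)
      subst hij
      rw [ih (by simpa using hl) fun x => f_injective i (h x)]

/-- An oriented edge lies in one cell only. Its direction determines `(i, j)`: equal differences of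
corners give equal midpoints, to which `vertices_of_f_eq` applies. One endpoint then fixes the
translation part of the cell map. -/
lemma edge_injective (hP : AffineIndependent ℝ P) {w w' : List (Fin 4)} {i j i' j' : Fin 4}
    (hl : w.length = w'.length) (hij : j ≠ i) (h1 : fw P w (P i) = fw P w' (P i'))
    (h2 : fw P w (P j) = fw P w' (P j')) : w = w' ∧ i = i' ∧ j = j' := by
  have h3 : P j - P i = P j' - P i' := by
    have h := fw_sub (P := P) w (P j) (P i)
    rw [h1, h2, fw_sub, ← hl] at h
    exact (smul_right_injective E3 (by positivity) h).symm
  have h4 : f P j (P i') = f P j' (P i) := by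
    simp only [f]
    congr 1
    have : P j - P i + (P i + P i') = P j' - P i' + (P i + P i') := by rw [h3]
    rw [add_comm (P i') (P j), add_comm (P i) (P j')]
    convert this using 1 <;> abel
  have hji : j = j' ∧ i = i' := by
    by_cases hjj : j = j'
    · subst hjj
      exact ⟨rfl, (hP.injective (f_injective j h4)).symm⟩
    · have h5 := (vertices_of_f_eq hP hjj (vertex_mem _) (vertex_mem _) h4).2
      exact absurd (hP.injective h5).symm hij
  obtain ⟨rfl, rfl⟩ := hji
  refine ⟨eq_of_fw_eq hP hl fun x => ?_, rfl, rfl⟩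
  have h := (fw_sub (P := P) w x (P i)).trans (hl ▸ (fw_sub (P := P) w' x (P i)).symm)
  rw [h1] at h
  exact sub_left_injective h

/-! ### Energy and Laplacian as sums over cells -/

open Classical in
-- Neighbours of `X` correspond to triples `(w, i, j)` with `f_w P_i = X` and `j ≠ i`; the
-- hypothesis `F X = 0` allows the diagonal terms `j = i` to be included.
lemma sum_neighbors (hP : AffineIndependent ℝ P) (m : ℕ) (X : E3) (F : E3 → ℝ) (hF : F X = 0) :
    ∑ Y ∈ (V P m).filter (Adj P m X), F Y =
      ∑ w ∈ words m, ∑ i, if fw P w (P i) = X then ∑ j, F (fw P w (P j)) else 0 := by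
  let T := (words m ×ˢ (Finset.univ : Finset (Fin 4 × Fin 4))).filter
    fun p => fw P p.1 (P p.2.1) = X ∧ p.2.2 ≠ p.2.1
  have h1 : ∑ p ∈ T, F (fw P p.1 (P p.2.2)) = ∑ Y ∈ (V P m).filter (Adj P m X), F Y := by
    refine Finset.sum_nbij (fun p => fw P p.1 (P p.2.2)) ?_ ?_ ?_ fun _ _ => rfl
    · rintro ⟨w, i, j⟩ hp
      simp only [T, Finset.mem_filter, Finset.mem_product, Finset.mem_univ, and_true] at hp
      obtain ⟨hw, rfl, hij⟩ := hp
      refine Finset.mem_filter.2 ⟨fw_vertex_mem_V hw j, fun h => ?_, w, mem_words.1 hw,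
        ⟨i, rfl⟩, j, rfl⟩
      exact hij (hP.injective (fw_injective w h)).symm
    · rintro ⟨w, i, j⟩ hp ⟨w', i', j'⟩ hp' h
      simp only [T, Finset.coe_filter, Set.mem_ofPred_eq, Finset.mem_product, Finset.mem_univ,
        and_true] at hp hp'
      obtain ⟨rfl, rfl, rfl⟩ := edge_injective hP
        ((mem_words.1 hp.1).trans (mem_words.1 hp'.1).symm) hp.2.2 (hp.2.1.trans hp'.2.1.symm) h
      rfl
    · rintro Y hY
      obtain ⟨-, hne, w, hw, ⟨i, rfl⟩, j, rfl⟩ := Finset.mem_filter.1 (Finset.mem_coe.1 hY)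
      refine ⟨(w, i, j), ?_, rfl⟩
      simp only [T, Finset.coe_filter, Set.mem_ofPred_eq, Finset.mem_product, Finset.mem_univ,
        and_true, mem_words]
      exact ⟨hw, trivial, fun h => hne (by rw [h])⟩
  rw [← h1, Finset.sum_filter, Finset.sum_product]
  refine Finset.sum_congr rfl fun w _ => ?_
  rw [Fintype.sum_prod_type]
  refine Finset.sum_congr rfl fun i _ => ?_
  split_ifs with hX
  · refine Finset.sum_congr rfl fun j _ => ?_
    split_ifs with h
    · rfl
    · have : j = i := by simpa [hX] using h
      simp only [this, hX, hF]
  · simp [hX]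

open Classical in
lemma sum_V_fiber (m : ℕ) (G : List (Fin 4) → Fin 4 → E3 → ℝ) :
    ∑ X ∈ V P m, ∑ w ∈ words m, ∑ i, (if fw P w (P i) = X then G w i X else 0) =
      ∑ w ∈ words m, ∑ i, G w i (fw P w (P i)) := by
  rw [Finset.sum_comm]
  refine Finset.sum_congr rfl fun w hw => ?_
  rw [Finset.sum_comm]
  refine Finset.sum_congr rfl fun i _ => ?_
  rw [Finset.sum_ite_eq, if_pos (fw_vertex_mem_V hw i)]

/-- The energy of the complete graph on four vertices. -/
noncomputable def Q (a b : Fin 4 → ℝ) : ℝ := (1 / 2) * ∑ i, ∑ j, (a i - a j) * (b i - b j)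

/-- The values of a function at the corners of a cell. -/
noncomputable def corners (P : Fin 4 → E3) (w : List (Fin 4)) (u : E3 → ℝ) : Fin 4 → ℝ :=
  fun i => u (fw P w (P i))

lemma energy_eq (hP : AffineIndependent ℝ P) (m : ℕ) (u v : E3 → ℝ) :
    energy P m u v = (r ^ m)⁻¹ * ∑ w ∈ words m, Q (corners P w u) (corners P w v) := by
  classical
  simp only [energy, Q, corners, ← Finset.mul_sum]
  congr 2
  rw [← sum_V_fiber m fun w i X => ∑ j, (u X - u (fw P w (P j))) * (v X - v (fw P w (P j)))]
  refine Finset.sum_congr rfl fun X _ => ?_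
  convert sum_neighbors hP m X (fun Y => (u X - u Y) * (v X - v Y)) (by simp)

open Classical in
lemma graphLaplacian_eq (hP : AffineIndependent ℝ P) (m : ℕ) (u : E3 → ℝ) (X : E3) :
    graphLaplacian P m u X = ∑ w ∈ words m, ∑ i,
      if fw P w (P i) = X then ∑ j, (u (fw P w (P j)) - u X) else 0 := by
  rw [graphLaplacian, ← sum_neighbors hP m X (fun Y => u Y - u X) (by simp)]

lemma Q_green (a b : Fin 4 → ℝ) : Q a b = -∑ i, b i * ∑ j, (a j - a i) := by
  simp only [Q, Fin.sum_univ_four]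
  ring

lemma energy_green (hP : AffineIndependent ℝ P) (m : ℕ) (u v : E3 → ℝ) :
    energy P m u v = -((r ^ m)⁻¹ * ∑ X ∈ V P m, v X * graphLaplacian P m u X) := by
  classical
  rw [energy_eq hP, ← mul_neg]
  congr 1
  simp only [Q_green, graphLaplacian_eq hP, Finset.sum_neg_distrib, neg_inj, Finset.mul_sum,
    mul_ite, mul_zero]
  rw [sum_V_fiber m fun w i X => ∑ j, v X * (u (fw P w (P j)) - u X)]
  rfl

/-! ### Counting the cells at a vertex -/

/-- The number of pairs `(w, i)`, `w` a word of length `m`, with `f_w P_i = X`. -/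
noncomputable def multiplicity (P : Fin 4 → E3) (m : ℕ) (X : E3) : ℝ :=
  open Classical in ∑ w ∈ words m, ∑ i, if fw P w (P i) = X then 1 else 0

open Classical in
-- Another copy `b` contains `f_a y` only if `y = P b`, and there the point is `f_b (P a)`.
lemma multiplicity_succ (hP : AffineIndependent ℝ P) (m : ℕ) (a : Fin 4) {y : E3}
    (hy : y ∈ ST P) : multiplicity P (m + 1) (f P a y) =
      multiplicity P m y + ∑ b ∈ Finset.univ.erase a, if y = P b then multiplicity P m (P a)
        else 0 := by
  rw [multiplicity, sum_words_succ, ← Finset.add_sum_erase _ _ (Finset.mem_univ a)]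
  congr 1
  · refine Finset.sum_congr rfl fun w _ => Finset.sum_congr rfl fun i _ => ?_
    exact if_congr (f_injective a).eq_iff rfl rfl
  · refine Finset.sum_congr rfl fun b hb => ?_
    have hba : b ≠ a := (Finset.mem_erase.1 hb).1
    rw [multiplicity]
    split_ifs with h
    · subst h
      refine Finset.sum_congr rfl fun w _ => Finset.sum_congr rfl fun i _ => ?_
      rw [f_comm]
      exact if_congr (f_injective b).eq_iff rfl rfl
    · refine Finset.sum_eq_zero fun w _ => Finset.sum_eq_zero fun i _ => if_neg fun h' => h ?_
      exact (vertices_of_f_eq hP hba (fw_mem w (vertex_mem i)) hy h').2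

lemma multiplicity_vertex (hP : AffineIndependent ℝ P) (m : ℕ) (i : Fin 4) :
    multiplicity P m (P i) = 1 := by
  classical
  induction m with
  | zero => simp only [multiplicity, sum_words_zero, fw, id, hP.injective.eq_iff,
      Finset.sum_ite_eq', Finset.mem_univ, if_true]
  | succ m ih =>
    have h := multiplicity_succ hP m i (vertex_mem i)
    rw [f_self, ih] at h
    rw [h, add_eq_left]
    refine Finset.sum_eq_zero fun b hb => if_neg fun h => ?_
    exact (Finset.mem_erase.1 hb).1 (hP.injective h).symm

/-- Descending into copies, the vertex eventually becomes some `f_a P_c` with `c ≠ a`, which the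
copies `a` and `c` share and count once each. -/
lemma multiplicity_eq_two (hP : AffineIndependent ℝ P) {m : ℕ} {X : E3} (hX : X ∈ V P m)
    (h0 : X ∉ V P 0) : multiplicity P m X = 2 := by
  classical
  induction m generalizing X with
  | zero => exact absurd hX h0
  | succ m ih =>
    obtain ⟨a, y, hy, rfl⟩ := mem_V_succ.1 hX
    rw [multiplicity_succ hP m a (mem_ST_of_mem_V hy)]
    by_cases hy0 : y ∈ V P 0
    · obtain ⟨c, rfl⟩ := mem_V_zero.1 hy0
      have hca : c ≠ a := by
        rintro rfl
        exact h0 (by rw [f_self]; exact vertex_mem_V 0 c)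
      simp only [multiplicity_vertex hP, hP.injective.eq_iff, Finset.sum_ite_eq]
      rw [if_pos (by simpa using hca)]
      norm_num
    · rw [ih hy hy0, add_eq_left]
      refine Finset.sum_eq_zero fun b _ => if_neg fun h => hy0 ?_
      exact h ▸ vertex_mem_V 0 b

lemma sum_words_corners (m : ℕ) (k : E3 → ℝ) :
    ∑ w ∈ words m, ∑ i, corners P w k i = ∑ X ∈ V P m, multiplicity P m X * k X := by
  classical
  simp only [multiplicity, Finset.sum_mul, ite_mul, one_mul, zero_mul]
  rw [sum_V_fiber m fun _ _ X => k X]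
  rfl

/-! ### The harmonic extension -/

/-- The values at the corners of the `i`-th cell of the harmonic function with boundary values
`a`. -/
noncomputable def M (i : Fin 4) (a : Fin 4 → ℝ) (j : Fin 4) : ℝ :=
  if j = i then a i else (∑ k, a k + a i + a j) / 6

lemma M_self (i : Fin 4) (a : Fin 4 → ℝ) : M i a i = a i := if_pos rfl

lemma M_comm (i j : Fin 4) (a : Fin 4 → ℝ) : M i a j = M j a i := by
  by_cases h : j = i
  · rw [h]
  · rw [M, M, if_neg h, if_neg (Ne.symm h)]
    ring

lemma sum_M (a : Fin 4 → ℝ) : ∑ i, ∑ j, M i a j = 4 * ∑ j, a j := by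
  simp [M, Fin.sum_univ_four]
  ring

lemma M_bounds {lo hi : ℝ} {a : Fin 4 → ℝ} (h : ∀ k, lo ≤ a k ∧ a k ≤ hi) (i j : Fin 4) :
    lo ≤ M i a j ∧ M i a j ≤ hi := by
  have h0 := h 0
  have h1 := h 1
  have h2 := h 2
  have h3 := h 3
  have hi' := h i
  have hj := h j
  rw [M, Fin.sum_univ_four]
  split_ifs
  · exact hi'
  · constructor <;> linarith

lemma M_osc {D : ℝ} {a : Fin 4 → ℝ} (h : ∀ i j, |a i - a j| ≤ D) (i j k : Fin 4) :
    |M i a j - M i a k| ≤ 2 / 3 * D := by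
  have hD : 0 ≤ D := (abs_nonneg _).trans (h 0 0)
  -- The difference is one sixth of `∑ k, (a i - a k) + (a i - a j)`, with at most four nonzero
  -- terms: hence `4/6 = 2/3`.
  have key : ∀ j, |a i - (∑ k, a k + a i + a j) / 6| ≤ 2 / 3 * D ∨ j = i := by
    intro j
    by_cases hj : j = i
    · exact Or.inr hj
    left
    have hs : ∑ k, (a i - a k) = 4 * a i - ∑ k, a k := by simp [Finset.sum_sub_distrib]
    have h1 : |∑ k ∈ Finset.univ.erase i, (a i - a k)| ≤ 3 * D := by
      refine (Finset.abs_sum_le_sum_abs _ _).trans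
        ((Finset.sum_le_card_nsmul _ _ D fun k _ => h i k).trans ?_)
      simp
    rw [← Finset.add_sum_erase _ _ (Finset.mem_univ i), sub_self, zero_add] at hs
    rw [hs] at h1
    have h2 := h i j
    rw [abs_le] at *
    constructor <;> linarith [h1.1, h1.2, h2.1, h2.2]
  by_cases hj : j = i <;> by_cases hk : k = i
  · simp only [hj, hk, sub_self, abs_zero]; positivity
  · rw [M, M, if_pos hj, if_neg hk]
    exact (key k).resolve_right hk
  · rw [M, M, if_neg hj, if_pos hk, abs_sub_comm]
    exact (key j).resolve_right hj
  · rw [M, M, if_neg hj, if_neg hk]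
    have := h j k
    rw [abs_le] at *
    constructor <;> linarith [this.1, this.2]

/-- The corner values of the harmonic function with boundary values `a` on the cell of level `n`
that contains the point with address `ω`. -/
noncomputable def iter : ℕ → (Fin 4 → ℝ) → (ℕ → Fin 4) → Fin 4 → ℝ
  | 0, a, _ => a
  | n + 1, a, ω => iter n (M (ω 0) a) (shift ω)

lemma iter_bounds {lo hi : ℝ} (n : ℕ) {a : Fin 4 → ℝ} (h : ∀ k, lo ≤ a k ∧ a k ≤ hi)
    (ω : ℕ → Fin 4) (k : Fin 4) : lo ≤ iter n a ω k ∧ iter n a ω k ≤ hi := by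
  induction n generalizing a ω with
  | zero => exact h k
  | succ n ih => exact ih (M_bounds h _) _

lemma iter_osc (n : ℕ) {D : ℝ} {a : Fin 4 → ℝ} (h : ∀ i j, |a i - a j| ≤ D) (ω : ℕ → Fin 4)
    (i j : Fin 4) : |iter n a ω i - iter n a ω j| ≤ (2 / 3) ^ n * D := by
  induction n generalizing a ω D with
  | zero => simpa [iter] using h i j
  | succ n ih =>
    rw [pow_succ, mul_assoc]
    exact ih (M_osc h _) _

lemma iter_step (n : ℕ) {D : ℝ} {a : Fin 4 → ℝ} (h : ∀ i j, |a i - a j| ≤ D) (ω : ℕ → Fin 4)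
    (k : Fin 4) : |iter n a ω k - iter (n + 1) a ω k| ≤ (2 / 3) ^ n * D := by
  induction n generalizing a ω D with
  | zero =>
    have hb := M_bounds (a := a) (lo := a k - D) (hi := a k + D) (fun l => by
      have := abs_le.1 (h l k)
      constructor <;> linarith [this.1, this.2]) (ω 0) k
    simp only [iter, pow_zero, one_mul]
    rw [abs_le]
    constructor <;> linarith [hb.1, hb.2]
  | succ n ih =>
    rw [pow_succ, mul_assoc]
    exact ih (M_osc h _) _

lemma exists_osc (a : Fin 4 → ℝ) : ∃ D, ∀ i j, |a i - a j| ≤ D := by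
  obtain ⟨D, hD⟩ := (Set.finite_range fun p : Fin 4 × Fin 4 => |a p.1 - a p.2|).bddAbove
  exact ⟨D, fun i j => hD ⟨(i, j), rfl⟩⟩

/-- The harmonic function with boundary values `a`, as a function of the address. -/
noncomputable def H (a : Fin 4 → ℝ) (ω : ℕ → Fin 4) : ℝ := limUnder atTop fun n => iter n a ω 0

/-- The oscillation over the corners decays like `(2/3)^n`, so the corner values form Cauchy
sequences with a limit independent of `k`. -/
lemma tendsto_iter (a : Fin 4 → ℝ) (ω : ℕ → Fin 4) (k : Fin 4) :
    Tendsto (fun n => iter n a ω k) atTop (𝓝 (H a ω)) := by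
  obtain ⟨D, hD⟩ := exists_osc a
  have hc : CauchySeq fun n => iter n a ω 0 :=
    cauchySeq_of_le_geometric (2 / 3) D (by norm_num) fun n => by
      rw [Real.dist_eq, mul_comm]
      exact iter_step n hD ω 0
  have h0 : Tendsto (fun n => (2 / 3 : ℝ) ^ n * D) atTop (𝓝 0) := by
    simpa using (tendsto_pow_atTop_nhds_zero_of_lt_one (by norm_num : (0 : ℝ) ≤ 2 / 3)
      (by norm_num)).mul_const D
  have h1 := squeeze_zero_norm (f := fun n => iter n a ω k - iter n a ω 0)
    (fun n => iter_osc n hD ω k 0) h0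
  simpa [H] using h1.add hc.tendsto_limUnder

lemma H_cons (a : Fin 4 → ℝ) (i : Fin 4) (ω : ℕ → Fin 4) : H a (cons i ω) = H (M i a) ω :=
  tendsto_nhds_unique ((tendsto_iter a (cons i ω) 0).comp (tendsto_add_atTop_nat 1))
    (tendsto_iter (M i a) ω 0)

lemma H_const (a : Fin 4 → ℝ) (i : Fin 4) : H a (fun _ => i) = a i := by
  have h : ∀ n, ∀ a, iter n a (fun _ => i) i = a i := by
    intro n
    induction n with
    | zero => exact fun _ => rfl
    | succ n ih => exact fun a => (ih _).trans (M_self i a)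
  exact tendsto_nhds_unique (tendsto_iter a _ i) (by simp only [h]; exact tendsto_const_nhds)

lemma H_bounds {lo hi : ℝ} {a : Fin 4 → ℝ} (h : ∀ k, lo ≤ a k ∧ a k ≤ hi) (ω : ℕ → Fin 4) :
    lo ≤ H a ω ∧ H a ω ≤ hi :=
  ⟨ge_of_tendsto' (tendsto_iter a ω 0) fun n => (iter_bounds n h ω 0).1,
    le_of_tendsto' (tendsto_iter a ω 0) fun n => (iter_bounds n h ω 0).2⟩

/-- A function of an address that depends continuously on it once the first letter is fixed is
continuous. -/
lemma continuous_head {G : Fin 4 → (ℕ → Fin 4) → ℝ} (h : ∀ i, Continuous (G i)) :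
    Continuous fun ω => G (ω 0) ω := by
  have h1 : (fun ω => G (ω 0) ω) =
      fun ω : ℕ → Fin 4 => ∑ i, (if ω 0 = i then 1 else 0) * G i ω := by
    funext ω
    simp
  rw [h1]
  refine continuous_finsetSum _ fun i _ => Continuous.mul ?_ (h i)
  exact (continuous_of_discreteTopology (f := fun k : Fin 4 => if k = i then (1 : ℝ) else 0)).comp
    (continuous_apply 0)

lemma continuous_iter (n : ℕ) (a : Fin 4 → ℝ) : Continuous fun ω => iter n a ω 0 := by
  induction n generalizing a with
  | zero => exact continuous_const
  | succ n ih =>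
    exact continuous_head (G := fun i ω => iter n (M i a) (shift ω) 0)
      fun i => (ih _).comp continuous_shift

lemma continuous_H (a : Fin 4 → ℝ) : Continuous (H a) := by
  obtain ⟨D, hD⟩ := exists_osc a
  have hu : TendstoUniformly (fun n ω => iter n a ω 0) (H a) atTop := by
    rw [Metric.tendstoUniformly_iff]
    intro ε hε
    have h0 : Tendsto (fun n => D * (2 / 3 : ℝ) ^ n / (1 - 2 / 3)) atTop (𝓝 0) := by
      simpa using ((tendsto_pow_atTop_nhds_zero_of_lt_one (by norm_num : (0 : ℝ) ≤ 2 / 3)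
        (by norm_num)).const_mul D).div_const (1 - 2 / 3)
    filter_upwards [h0.eventually_lt_const hε] with n hn ω
    rw [dist_comm]
    refine lt_of_le_of_lt (dist_le_of_le_geometric_of_tendsto (2 / 3) D (by norm_num)
      (fun n => ?_) (tendsto_iter a ω 0) n) hn
    rw [Real.dist_eq, mul_comm]
    exact iter_step n hD ω 0
  exact hu.continuous (Eventually.of_forall fun n => continuous_iter n a).frequently

/-- Two addresses of a point agree, or they agree up to a letter after which they are constant. -/
lemma code_eq_iff_cases (hP : AffineIndependent ℝ P) {ω ω' : ℕ → Fin 4}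
    (h : code P ω = code P ω') :
    (ω 0 = ω' 0 ∧ code P (shift ω) = code P (shift ω')) ∨
      (shift ω = (fun _ => ω' 0) ∧ shift ω' = fun _ => ω 0) := by
  rw [code_eq, code_eq ω'] at h
  by_cases h0 : ω 0 = ω' 0
  · rw [h0] at h
    exact Or.inl ⟨h0, f_injective _ h⟩
  · have h1 := vertices_of_f_eq hP h0 (code_mem _) (code_mem _) h
    exact Or.inr ⟨eq_const_of_code_eq hP h1.1, eq_const_of_code_eq hP h1.2⟩

/-- While two addresses of a point share letters, each letter shrinks the bound by `2/3`. If they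
separate, both lead to the point `f_i P_j = f_j P_i`, where `M_comm` makes the values equal. -/
lemma H_factors (hP : AffineIndependent ℝ P) (a : Fin 4 → ℝ) :
    (H a).FactorsThrough (code P) := by
  have key : ∀ n, ∀ a : Fin 4 → ℝ, ∀ D, (∀ i j, |a i - a j| ≤ D) → ∀ ω ω',
      code P ω = code P ω' → |H a ω - H a ω'| ≤ (2 / 3) ^ n * (2 * D) := by
    intro n
    induction n with
    | zero =>
      intro a D hD ω ω' _
      have hb : ∀ l, a 0 - D ≤ a l ∧ a l ≤ a 0 + D := fun l => by
        have := abs_le.1 (hD l 0)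
        constructor <;> linarith [this.1, this.2]
      have h1 := H_bounds hb ω
      have h2 := H_bounds hb ω'
      rw [abs_le]
      constructor <;> linarith [h1.1, h1.2, h2.1, h2.2]
    | succ n ih =>
      intro a D hD ω ω' h
      rw [← cons_shift ω, ← cons_shift ω', H_cons, H_cons]
      rcases code_eq_iff_cases hP h with ⟨h0, h1⟩ | ⟨h1, h2⟩
      · rw [h0, pow_succ, mul_assoc, mul_left_comm (2 / 3 : ℝ)]
        exact ih _ _ (M_osc hD _) _ _ h1
      · have hD0 : 0 ≤ D := (abs_nonneg _).trans (hD 0 0)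
        rw [h1, h2, H_const, H_const, M_comm, sub_self, abs_zero]
        positivity
  intro ω ω' h
  obtain ⟨D, hD⟩ := exists_osc a
  have h0 : Tendsto (fun n => (2 / 3 : ℝ) ^ n * (2 * D)) atTop (𝓝 0) := by
    simpa using (tendsto_pow_atTop_nhds_zero_of_lt_one (by norm_num : (0 : ℝ) ≤ 2 / 3)
      (by norm_num)).mul_const (2 * D)
  have := ge_of_tendsto' h0 fun n => key n a D hD ω ω' h
  exact sub_eq_zero.1 (abs_nonpos_iff.1 this)

/-- The harmonic function with boundary values `a`. -/
noncomputable def harm (P : Fin 4 → E3) (a : Fin 4 → ℝ) : E3 → ℝ :=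
  Function.extend (code P) (H a) 0

lemma harm_code (hP : AffineIndependent ℝ P) (a : Fin 4 → ℝ) (ω : ℕ → Fin 4) :
    harm P a (code P ω) = H a ω := (H_factors hP a).extend_apply 0 ω

lemma harm_vertex (hP : AffineIndependent ℝ P) (a : Fin 4 → ℝ) (i : Fin 4) :
    harm P a (P i) = a i := by
  conv_lhs => rw [← code_const (P := P) i, harm_code hP, H_const]

lemma harm_f (hP : AffineIndependent ℝ P) (a : Fin 4 → ℝ) (i : Fin 4) {x : E3} (hx : x ∈ ST P) :
    harm P a (f P i x) = harm P (M i a) x := by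
  obtain ⟨ω, rfl⟩ := hx
  rw [← code_cons, harm_code hP, harm_code hP, H_cons]

lemma continuousOn_harm (hP : AffineIndependent ℝ P) (a : Fin 4 → ℝ) :
    ContinuousOn (harm P a) (ST P) := by
  refine continuousOn_of_code ?_
  simp only [harm_code hP]
  exact continuous_H a

lemma harm_bounds (hP : AffineIndependent ℝ P) {lo hi : ℝ} {a : Fin 4 → ℝ}
    (h : ∀ k, lo ≤ a k ∧ a k ≤ hi) {x : E3} (hx : x ∈ ST P) :
    lo ≤ harm P a x ∧ harm P a x ≤ hi := by
  obtain ⟨ω, rfl⟩ := hx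
  rw [harm_code hP]
  exact H_bounds h ω

/-! ### Splines -/

/-- The copies meet only in the points `f_i P_j = f_j P_i`, so `hc` is the whole compatibility
condition. -/
lemma exists_glue (hP : AffineIndependent ℝ P) {F : Fin 4 → E3 → ℝ}
    (hF : ∀ i, ContinuousOn (F i) (ST P)) (hc : ∀ i j, F i (P j) = F j (P i)) :
    ∃ ψ : E3 → ℝ, ContinuousOn ψ (ST P) ∧ ∀ i, ∀ x ∈ ST P, ψ (f P i x) = F i x := by
  let G : (ℕ → Fin 4) → ℝ := fun ω => F (ω 0) (code P (shift ω))
  have hG : Continuous G := continuous_head (G := fun i ω => F i (code P (shift ω)))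
    fun i => (continuous_comp_code (hF i)).comp continuous_shift
  have hfac : G.FactorsThrough (code P) := by
    intro ω ω' h
    rcases code_eq_iff_cases hP h with ⟨h0, h1⟩ | ⟨h1, h2⟩
    · simp only [G, h0, h1]
    · simp only [G, h1, h2, code_const]
      exact hc _ _
  refine ⟨Function.extend (code P) G 0, continuousOn_of_code ?_, ?_⟩
  · simp only [hfac.extend_apply]
    exact hG
  · rintro i _ ⟨ω, rfl⟩
    rw [← code_cons, hfac.extend_apply]
    rfl

/-- `ψ` is harmonic on the cells of level `m`. -/
def IsPiecewiseHarmonic (P : Fin 4 → E3) (m : ℕ) (ψ : E3 → ℝ) : Prop :=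
  ContinuousOn ψ (ST P) ∧
    ∀ w ∈ words m, ∀ x ∈ ST P, ψ (fw P w x) = harm P (corners P w ψ) x

lemma exists_piecewiseHarmonic (hP : AffineIndependent ℝ P) (m : ℕ) (c : E3 → ℝ) :
    ∃ ψ, IsPiecewiseHarmonic P m ψ ∧ ∀ X ∈ V P m, ψ X = c X := by
  -- Stated with the corner values of `c`, for all `c`, so that induction applies to each `c ∘ f P
  -- i`.
  have key : ∀ c : E3 → ℝ, ∃ ψ, ContinuousOn ψ (ST P) ∧
      ∀ w ∈ words m, ∀ x ∈ ST P, ψ (fw P w x) = harm P (corners P w c) x := by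
    induction m with
    | zero =>
      refine fun c => ⟨harm P fun i => c (P i), continuousOn_harm hP _, fun w hw x _ => ?_⟩
      obtain rfl : w = [] := by simpa [words] using hw
      rfl
    | succ m ih =>
      intro c
      choose F hF hFw using fun i => ih (c ∘ f P i)
      have hv : ∀ i j, F i (P j) = c (f P i (P j)) := fun i j => by
        obtain ⟨w, hw, k, hk⟩ := mem_V.1 (vertex_mem_V (P := P) m j)
        rw [← hk, hFw i w hw _ (vertex_mem k), harm_vertex hP]
        rfl
      obtain ⟨ψ, hψ, hψF⟩ := exists_glue hP hF fun i j => by rw [hv, hv, f_comm]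
      refine ⟨ψ, hψ, fun w hw x hx => ?_⟩
      cases w with
      | nil => simp [mem_words] at hw
      | cons i w =>
        have hw' : w ∈ words m := by simpa [mem_words] using hw
        exact (hψF i _ (fw_mem w hx)).trans (hFw i w hw' x hx)
  obtain ⟨ψ, hψ, h⟩ := key c
  have hv : ∀ w ∈ words m, ∀ i, ψ (fw P w (P i)) = c (fw P w (P i)) := fun w hw i => by
    rw [h w hw _ (vertex_mem i), harm_vertex hP]
    rfl
  refine ⟨ψ, ⟨hψ, fun w hw x hx => ?_⟩, fun X hX => ?_⟩
  · rw [h w hw x hx]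
    congr 1
    funext i
    exact (hv w hw i).symm
  · obtain ⟨w, hw, i, rfl⟩ := mem_V.1 hX
    exact hv w hw i

/-! ### Energies of harmonic functions -/

open Classical in
lemma energy_congr {m : ℕ} {u u' v v' : E3 → ℝ} (hu : ∀ x ∈ ST P, u x = u' x)
    (hv : ∀ x ∈ ST P, v x = v' x) : energy P m u v = energy P m u' v' := by
  unfold energy
  congr 2
  refine Finset.sum_congr rfl fun X hX => Finset.sum_congr rfl fun Y hY => ?_
  have hX' := mem_ST_of_mem_V hX
  have hY' := mem_ST_of_mem_V (Finset.mem_filter.1 hY).1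
  rw [hu X hX', hu Y hY', hv X hX', hv Y hY']

lemma energy_comm (m : ℕ) (u v : E3 → ℝ) : energy P m u v = energy P m v u := by
  simp only [energy, mul_comm]

lemma energy_sub_left (m : ℕ) (u u' v : E3 → ℝ) :
    energy P m (u - u') v = energy P m u v - energy P m u' v := by
  simp only [energy, ← mul_sub, ← Finset.sum_sub_distrib, Pi.sub_apply]
  congr 2
  refine Finset.sum_congr rfl fun X _ => Finset.sum_congr rfl fun Y _ => ?_
  ring

lemma energy_sub_right (m : ℕ) (u v v' : E3 → ℝ) :
    energy P m u (v - v') = energy P m u v - energy P m u v' := by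
  rw [energy_comm, energy_sub_left, energy_comm, energy_comm m v']

lemma energy_nonneg (m : ℕ) (u : E3 → ℝ) : 0 ≤ energy P m u u := by
  unfold energy r
  refine mul_nonneg (by positivity) (mul_nonneg (by norm_num) ?_)
  exact Finset.sum_nonneg fun X _ => Finset.sum_nonneg fun Y _ => mul_self_nonneg _

lemma energy_zero (hP : AffineIndependent ℝ P) (u v : E3 → ℝ) :
    energy P 0 u v = Q (fun i => u (P i)) fun i => v (P i) := by
  rw [energy_eq hP, sum_words_zero, pow_zero, inv_one, one_mul]
  rfl

lemma energy_add (hP : AffineIndependent ℝ P) (m k : ℕ) (u v : E3 → ℝ) :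
    energy P (m + k) u v =
      (r ^ m)⁻¹ * ∑ w ∈ words m, energy P k (u ∘ fw P w) (v ∘ fw P w) := by
  simp only [energy_eq hP, sum_words_add, ← Finset.mul_sum, pow_add, mul_inv, mul_assoc]
  congr 2
  refine Finset.sum_congr rfl fun w _ => Finset.sum_congr rfl fun v' _ => ?_
  congr 1 <;> (funext i; simp only [corners, fw_append, Function.comp_apply])

/-- The values given by `M` are balanced at the midpoints, so the midpoint values of `b` cancel and
only `b i i` remains. Symmetry of `b` expresses that `f_i P_j = f_j P_i`. -/
lemma sum_Q_M (a : Fin 4 → ℝ) (b : Fin 4 → Fin 4 → ℝ) (hb : ∀ i j, b i j = b j i) :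
    ∑ i, Q (M i a) (b i) = r * Q a fun i => b i i := by
  simp only [Q, M, r, Fin.sum_univ_four, Fin.isValue, Fin.reduceEq, if_true, if_false,
    hb 1 0, hb 2 0, hb 3 0, hb 2 1, hb 3 1, hb 3 2]
  ring

lemma energy_harm (hP : AffineIndependent ℝ P) (k : ℕ) (a : Fin 4 → ℝ) (v : E3 → ℝ) :
    energy P k (harm P a) v = Q a fun i => v (P i) := by
  have hr : r ≠ 0 := by norm_num [r]
  induction k generalizing a v with
  | zero =>
    rw [energy_zero hP]
    simp only [harm_vertex hP]
  | succ k ih =>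
    rw [add_comm, energy_add hP, sum_words_succ]
    simp only [sum_words_zero]
    have h1 : ∀ i, energy P k (harm P a ∘ fw P [i]) (v ∘ fw P [i]) =
        Q (M i a) fun j => v (f P i (P j)) := fun i => by
      refine Eq.trans ?_ (ih (M i a) (v ∘ f P i))
      exact energy_congr (fun x hx => harm_f hP a i hx) fun _ _ => rfl
    simp only [h1]
    rw [sum_Q_M a (fun i j => v (f P i (P j))) fun i j => by rw [f_comm], pow_one,
      inv_mul_cancel_left₀ hr]
    simp only [f_self]

lemma energy_piecewiseHarmonic (hP : AffineIndependent ℝ P) {m : ℕ} {ψ : E3 → ℝ}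
    (hψ : IsPiecewiseHarmonic P m ψ) (k : ℕ) (v : E3 → ℝ) :
    energy P (m + k) ψ v = energy P m ψ v := by
  rw [energy_add hP, energy_eq hP]
  congr 1
  refine Finset.sum_congr rfl fun w hw => ?_
  exact (energy_congr (hψ.2 w hw) fun _ _ => rfl).trans (energy_harm hP _ _ _)

lemma piecewiseHarmonic_mem_domE (hP : AffineIndependent ℝ P) {m : ℕ} {ψ : E3 → ℝ}
    (hψ : IsPiecewiseHarmonic P m ψ) : ψ ∈ domE P := by
  refine ⟨hψ.1, energy P m ψ ψ, tendsto_atTop_of_eventually_const (i₀ := m) fun k hk => ?_⟩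
  obtain ⟨l, rfl⟩ := Nat.exists_eq_add_of_le hk
  exact energy_piecewiseHarmonic hP hψ l ψ

lemma piecewiseHarmonic_harm (hP : AffineIndependent ℝ P) (a : Fin 4 → ℝ) :
    IsPiecewiseHarmonic P 0 (harm P a) := by
  refine ⟨continuousOn_harm hP a, fun w hw x _ => ?_⟩
  obtain rfl : w = [] := by simpa [words] using hw
  have h : corners P [] (harm P a) = a := funext fun i => harm_vertex hP a i
  rw [h]
  rfl

lemma Q_zero_right (a : Fin 4 → ℝ) : (Q a fun _ => 0) = 0 := by simp [Q]

lemma isHarmonic_of_eq_harm (hP : AffineIndependent ℝ P) {u : E3 → ℝ} {a : Fin 4 → ℝ}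
    (h : ∀ x ∈ ST P, u x = harm P a x) : IsHarmonic P u := by
  have hc : ContinuousOn u (ST P) := (continuousOn_harm hP a).congr h
  refine ⟨⟨hc, ?_⟩, continuousOn_const, fun v hv => ?_⟩
  · obtain ⟨L, hL⟩ := (piecewiseHarmonic_mem_domE hP (piecewiseHarmonic_harm hP a)).2
    exact ⟨L, hL.congr fun m => (energy_congr h h).symm⟩
  · have h0 : ∀ m, energy P m u v = 0 := fun m => by
      rw [energy_congr h fun _ _ => rfl, energy_harm hP]
      simp only [hv.2 _ (vertex_mem_V 0 _), Q_zero_right]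
    simp [h0]

/-- Among the functions with given values on `V_0`, the harmonic one has least energy. -/
lemma energy_zero_le (hP : AffineIndependent ℝ P) (k : ℕ) (u : E3 → ℝ) :
    energy P 0 u u ≤ energy P k u u := by
  set a : Fin 4 → ℝ := fun i => u (P i)
  -- With `h` the harmonic function, both the energy of `h` and its pairing with `u` equal `Q a a`,
  -- so the energy of `u - h` is that of `u` minus `Q a a`.
  have h := energy_nonneg (P := P) k (u - harm P a)
  rw [energy_sub_left, energy_sub_right, energy_sub_right, energy_comm k u (harm P a),
    energy_harm hP, energy_harm hP] at h
  simp only [harm_vertex hP] at h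
  rw [energy_zero hP]
  linarith

lemma energy_mono (hP : AffineIndependent ℝ P) (u : E3 → ℝ) :
    Monotone fun m => energy P m u u := by
  refine monotone_nat_of_le_succ fun m => ?_
  have h0 := energy_add hP m 0 u u
  rw [add_zero] at h0
  rw [h0, energy_add hP]
  have : 0 < r := by norm_num [r]
  gcongr
  exact energy_zero_le hP 1 _

/-! ### Uniqueness of harmonic functions -/

/-- Truncating an address and continuing with the constant letter `i` gives points `f_w P_i` that
converge to the given point. -/
lemma dense_vertices {u : E3 → ℝ} (hu : ContinuousOn u (ST P)) {i : Fin 4} {c : ℝ}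
    (h : ∀ w, u (fw P w (P i)) = c) {x : E3} (hx : x ∈ ST P) : u x = c := by
  obtain ⟨ω, rfl⟩ := hx
  let t : ℕ → (ℕ → Fin 4) := fun n k => if k < n then ω k else i
  have hcode : ∀ n, ∀ ω : ℕ → Fin 4, ∃ w,
      code P (fun k => if k < n then ω k else i) = fw P w (P i) := by
    intro n
    induction n with
    | zero => exact fun _ => ⟨[], by simp [code_const, fw]⟩
    | succ n ih =>
      intro ω
      obtain ⟨w, hw⟩ := ih (shift ω)
      refine ⟨ω 0 :: w, ?_⟩
      rw [code_eq]
      have : shift (fun k => if k < n + 1 then ω k else i) =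
          fun k => if k < n then shift ω k else i := by
        funext k
        simp [shift]
      rw [this, hw]
      rfl
  have ht : Tendsto t atTop (𝓝 ω) := by
    rw [tendsto_pi_nhds]
    exact fun k => tendsto_atTop_of_eventually_const (i₀ := k + 1) fun n hn =>
      if_pos (by omega)
  have h1 := ((continuous_comp_code hu).tendsto ω).comp ht
  have h2 : ∀ n, u (code P (t n)) = c := fun n => by
    obtain ⟨w, hw⟩ := hcode n ω
    rw [hw, h]
  exact tendsto_nhds_unique h1 (by simp only [Function.comp_def, h2]; exact tendsto_const_nhds)

lemma Q_eq_zero {a : Fin 4 → ℝ} (h : Q a a = 0) (i j : Fin 4) : a i = a j := by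
  have h1 : ∑ i, ∑ j, (a i - a j) * (a i - a j) = 0 := by
    rw [Q] at h
    linarith
  have h2 := (Finset.sum_eq_zero_iff_of_nonneg fun i _ =>
    Finset.sum_nonneg fun j _ => mul_self_nonneg (a i - a j)).1 h1 i (Finset.mem_univ i)
  have h3 := (Finset.sum_eq_zero_iff_of_nonneg fun j _ => mul_self_nonneg (a i - a j)).1 h2 j
    (Finset.mem_univ j)
  exact sub_eq_zero.1 (mul_self_eq_zero.1 h3)

lemma Q_nonneg (a : Fin 4 → ℝ) : 0 ≤ Q a a := by
  have := Finset.sum_nonneg fun i (_ : i ∈ Finset.univ) =>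
    Finset.sum_nonneg fun j (_ : j ∈ Finset.univ) => mul_self_nonneg (a i - a j)
  unfold Q
  positivity

lemma const_of_energy_eq_zero (hP : AffineIndependent ℝ P) {u : E3 → ℝ}
    (hu : ContinuousOn u (ST P)) (h : ∀ m, energy P m u u = 0) {x : E3} (hx : x ∈ ST P) :
    u x = u (P 0) := by
  have hQ : ∀ w i j, u (fw P w (P i)) = u (fw P w (P j)) := by
    intro w i j
    have h1 := h w.length
    rw [energy_eq hP, mul_eq_zero, or_iff_right (by norm_num [r])] at h1
    have h2 := (Finset.sum_eq_zero_iff_of_nonneg fun w _ => Q_nonneg _).1 h1 w (mem_words.2 rfl)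
    exact Q_eq_zero h2 i j
  refine dense_vertices hu (i := 0) (fun w => ?_) hx
  induction w using List.reverseRecOn with
  | nil => rfl
  | append_singleton w i ih =>
    rw [hQ _ 0 i, fw_append]
    change u (fw P w (f P i (P i))) = _
    rw [f_self, hQ w i 0, ih]

/-- The difference `d` from the harmonic function vanishes on `V_0`, so it is an admissible test
function, and its energy equals the energy of `u` against `d`, which tends to zero. Energies
increase with the level, so all of them vanish. -/
lemma eq_harm_of_isHarmonic (hP : AffineIndependent ℝ P) {u : E3 → ℝ} (hu : IsHarmonic P u)
    {x : E3} (hx : x ∈ ST P) : u x = harm P (fun i => u (P i)) x := by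
  obtain ⟨⟨hc, L, hL⟩, -, ht⟩ := hu
  set a : Fin 4 → ℝ := fun i => u (P i)
  set d := u - harm P a
  have hdv : ∀ i, d (P i) = 0 := fun i => by simp [d, harm_vertex hP, a]
  have hdc : ContinuousOn d (ST P) := hc.sub (continuousOn_harm hP a)
  have hd : ∀ m, energy P m d d = energy P m u d := fun m => by
    conv_lhs => rw [energy_sub_left, energy_harm hP]
    simp only [hdv, Q_zero_right, sub_zero]
  have hd' : ∀ m, energy P m u d = energy P m u u - Q a a := fun m => by
    rw [energy_sub_right, energy_comm m u (harm P a), energy_harm hP]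
  have hmem : d ∈ domE₀ P := by
    refine ⟨⟨hdc, L - Q a a, ?_⟩, fun X hX => ?_⟩
    · simp only [hd, hd']
      exact hL.sub_const _
    · obtain ⟨i, rfl⟩ := mem_V_zero.1 hX
      exact hdv i
  have h0 := ht d hmem
  simp only [mul_zero, integral_zero, neg_zero, ← hd] at h0
  have hz : ∀ m, energy P m d d = 0 := fun m =>
    le_antisymm ((energy_mono hP d).ge_of_tendsto h0 m) (energy_nonneg m d)
  have h1 := const_of_energy_eq_zero hP hdc hz hx
  rw [hdv] at h1
  exact sub_eq_zero.1 h1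

/-! ### Integration -/

instance : IsProbabilityMeasure bernoulli := by
  unfold bernoulli
  infer_instance

/-- The integral over the tetrahedron, as an integral over the space of addresses. -/
noncomputable def avg (P : Fin 4 → E3) (F : E3 → ℝ) : ℝ := ∫ ω, F (code P ω) ∂bernoulli

lemma integral_ST {F : E3 → ℝ} (hF : ContinuousOn F (ST P)) :
    ∫ x in ST P, F x ∂(mu P) = avg P F := by
  have hm : MeasurableSet (ST P) := (isCompact_ST P).isClosed.measurableSet
  have hr : (mu P).restrict (ST P) = mu P := by
    refine Measure.restrict_eq_self_of_ae_mem ?_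
    exact (ae_map_iff (continuous_code P).aemeasurable hm).2 (Eventually.of_forall code_mem)
  have hs : AEStronglyMeasurable F (mu P) := hr ▸ hF.aestronglyMeasurable hm
  rw [hr, mu, integral_map (continuous_code P).aemeasurable hs]
  rfl

lemma integrable_code {G : (ℕ → Fin 4) → ℝ} (hG : Continuous G) : Integrable G bernoulli :=
  hG.integrable_of_hasCompactSupport (HasCompactSupport.of_compactSpace G)

lemma avg_split {F : E3 → ℝ} (hF : ContinuousOn F (ST P)) :
    avg P F = (1 / 4) * ∑ i, avg P (F ∘ f P i) := by
  have hc := continuous_comp_code hF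
  have hi : ∀ i, AEMeasurable (cons i) bernoulli := fun i => (continuous_cons i).aemeasurable
  conv_lhs => rw [avg, bernoulli_eq]
  rw [integral_smul_measure, integral_finsetSum_measure fun i _ =>
    (integrable_map_measure hc.aestronglyMeasurable (hi i)).2
      (integrable_code (hc.comp (continuous_cons i)))]
  simp only [ENNReal.toReal_inv, ENNReal.toReal_ofNat, smul_eq_mul, one_div]
  congr 1
  refine Finset.sum_congr rfl fun i _ => ?_
  rw [integral_map (hi i) hc.aestronglyMeasurable]
  simp only [code_cons]
  rfl

lemma avg_words (m : ℕ) {F : E3 → ℝ} (hF : ContinuousOn F (ST P)) :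
    avg P F = (1 / 4) ^ m * ∑ w ∈ words m, avg P (F ∘ fw P w) := by
  induction m generalizing F with
  | zero => simp [sum_words_zero, fw]
  | succ m ih =>
    rw [avg_split hF, sum_words_succ, pow_succ', mul_assoc]
    congr 1
    rw [Finset.mul_sum]
    exact Finset.sum_congr rfl fun i _ => ih (continuousOn_comp_fw hF [i])

lemma avg_congr {F G : E3 → ℝ} (h : ∀ x ∈ ST P, F x = G x) : avg P F = avg P G :=
  integral_congr_ae (Eventually.of_forall fun ω => h _ (code_mem ω))

lemma abs_avg_sub_le {F : E3 → ℝ} (hF : ContinuousOn F (ST P)) {c ε : ℝ}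
    (h : ∀ x ∈ ST P, |F x - c| ≤ ε) : |avg P F - c| ≤ ε := by
  have h1 : avg P F - c = ∫ ω, (F (code P ω) - c) ∂bernoulli := by
    rw [integral_sub (integrable_code (continuous_comp_code hF)) (integrable_const c)]
    simp [avg]
  rw [h1, ← Real.norm_eq_abs]
  refine (norm_integral_le_of_norm_le_const (C := ε)
    (Eventually.of_forall fun ω => h _ (code_mem ω))).trans ?_
  simp

/-- The oscillation of a continuous function on the cells of level `m` tends to zero. -/
lemma osc_cells {F : E3 → ℝ} (hF : ContinuousOn F (ST P)) {ε : ℝ} (hε : 0 < ε) :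
    ∃ N, ∀ m ≥ N, ∀ w ∈ words m, ∀ x ∈ ST P, ∀ y ∈ ST P, |F (fw P w x) - F (fw P w y)| < ε := by
  obtain ⟨δ, hδ, h⟩ := Metric.uniformContinuousOn_iff.1
    ((isCompact_ST P).uniformContinuousOn_of_continuous hF) ε hε
  obtain ⟨D, hD⟩ := Metric.isBounded_iff.1 (isCompact_ST P).isBounded
  have h0 : Tendsto (fun m => (2⁻¹ : ℝ) ^ m * D) atTop (𝓝 0) := by
    simpa using (tendsto_pow_atTop_nhds_zero_of_lt_one (by norm_num : (0 : ℝ) ≤ 2⁻¹)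
      (by norm_num)).mul_const D
  obtain ⟨N, hN⟩ := eventually_atTop.1 (h0.eventually_lt_const hδ)
  refine ⟨N, fun m hm w hw x hx y hy => h _ (fw_mem w hx) _ (fw_mem w hy) ?_⟩
  refine lt_of_le_of_lt ?_ (hN m hm)
  rw [dist_eq_norm, fw_sub, norm_smul, norm_pow, mem_words.1 hw, ← dist_eq_norm,
    Real.norm_of_nonneg (by norm_num : (0 : ℝ) ≤ 2⁻¹)]
  gcongr
  exact hD hx hy

lemma abs_mean_words_le (m : ℕ) {G : List (Fin 4) → ℝ} {ε : ℝ} (h : ∀ w ∈ words m, |G w| ≤ ε) :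
    |(1 / 4) ^ m * ∑ w ∈ words m, G w| ≤ ε := by
  rw [abs_mul, abs_of_nonneg (by positivity : (0 : ℝ) ≤ (1 / 4) ^ m)]
  calc (1 / 4) ^ m * |∑ w ∈ words m, G w| ≤ (1 / 4) ^ m * (4 ^ m * ε) := by
        gcongr
        refine (Finset.abs_sum_le_sum_abs _ _).trans ?_
        rw [← card_words, ← nsmul_eq_mul]
        exact Finset.sum_le_card_nsmul _ _ _ h
    _ = ε := by rw [← mul_assoc, ← mul_pow]; norm_num

lemma abs_mean_corners_le {a : Fin 4 → ℝ} {ε : ℝ} (h : ∀ i, |a i| ≤ ε) :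
    |(1 / 4) * ∑ i, a i| ≤ ε := by
  rw [Fin.sum_univ_four, abs_le]
  have h' := fun i => abs_le.1 (h i)
  constructor <;> linarith [(h' 0).1, (h' 1).1, (h' 2).1, (h' 3).1, (h' 0).2, (h' 1).2, (h' 2).2,
    (h' 3).2]

/-- The mean of a function over the corners of the cells of level `m`. -/
noncomputable def riemannSum (P : Fin 4 → E3) (m : ℕ) (F : E3 → ℝ) : ℝ :=
  (1 / 4) ^ m * ∑ w ∈ words m, (1 / 4) * ∑ i, corners P w F i

lemma abs_riemannSum_le (m : ℕ) {F : E3 → ℝ} {ε : ℝ} (h : ∀ X ∈ V P m, |F X| ≤ ε) :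
    |riemannSum P m F| ≤ ε :=
  abs_mean_words_le m fun _ hw => abs_mean_corners_le fun i => h _ (fw_vertex_mem_V hw i)

lemma riemannSum_sub (m : ℕ) (F G : E3 → ℝ) :
    riemannSum P m (F - G) = riemannSum P m F - riemannSum P m G := by
  simp only [riemannSum, corners, Pi.sub_apply, Finset.sum_sub_distrib, mul_sub]

lemma tendsto_riemannSum {F : E3 → ℝ} (hF : ContinuousOn F (ST P)) :
    Tendsto (fun m => riemannSum P m F) atTop (𝓝 (avg P F)) := by
  rw [Metric.tendsto_atTop]
  intro ε hε
  obtain ⟨N, hN⟩ := osc_cells hF (half_pos hε)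
  refine ⟨N, fun m hm => lt_of_le_of_lt ?_ (half_lt_self hε)⟩
  rw [Real.dist_eq, avg_words m hF, riemannSum, ← mul_sub, ← Finset.sum_sub_distrib]
  refine abs_mean_words_le m fun w hw => ?_
  have h1 : (1 / 4) * ∑ i, corners P w F i - avg P (F ∘ fw P w) =
      (1 / 4) * ∑ i, (corners P w F i - avg P (F ∘ fw P w)) := by
    simp [Finset.sum_sub_distrib, mul_sub]
  rw [h1]
  refine abs_mean_corners_le fun i => ?_
  rw [abs_sub_comm]
  exact abs_avg_sub_le (continuousOn_comp_fw hF w) fun x hx =>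
    (hN m hm w hw x hx _ (vertex_mem i)).le

/-- By `sum_M`, one step of harmonic extension preserves the mean of the corner values. -/
lemma riemannSum_harm (hP : AffineIndependent ℝ P) (m : ℕ) (a : Fin 4 → ℝ) :
    riemannSum P m (harm P a) = (1 / 4) * ∑ i, a i := by
  induction m generalizing a with
  | zero => simp [riemannSum, sum_words_zero, corners, fw, harm_vertex hP]
  | succ m ih =>
    have h1 : riemannSum P (m + 1) (harm P a) =
        (1 / 4) * ∑ i, riemannSum P m (harm P (M i a)) := by
      simp only [riemannSum, sum_words_succ, pow_succ', mul_assoc, ← Finset.mul_sum]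
      congr 4
      funext i
      refine Finset.sum_congr rfl fun w _ => Finset.sum_congr rfl fun j _ => ?_
      exact harm_f hP a i (fw_mem w (vertex_mem j))
    simp only [h1, ih, ← Finset.mul_sum, sum_M]
    ring

lemma avg_harm (hP : AffineIndependent ℝ P) (a : Fin 4 → ℝ) :
    avg P (harm P a) = (1 / 4) * ∑ i, a i :=
  tendsto_nhds_unique (tendsto_riemannSum (continuousOn_harm hP a))
    (by simp only [riemannSum_harm hP]; exact tendsto_const_nhds)

lemma avg_piecewiseHarmonic (hP : AffineIndependent ℝ P) {m : ℕ} {ψ : E3 → ℝ}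
    (hψ : IsPiecewiseHarmonic P m ψ) : avg P ψ = riemannSum P m ψ := by
  rw [avg_words m hψ.1, riemannSum]
  congr 1
  refine Finset.sum_congr rfl fun w hw => ?_
  exact (avg_congr (hψ.2 w hw)).trans (avg_harm hP _)

/-! ### Splines at a vertex -/

lemma exists_isSpline (hP : AffineIndependent ℝ P) (m : ℕ) {X : E3} (hX : X ∈ V P m) :
    ∃ ψ, IsSpline P m X ψ := by
  classical
  obtain ⟨ψ, hψ, hv⟩ := exists_piecewiseHarmonic hP m fun Y => if Y = X then 1 else 0
  exact ⟨ψ, hψ.1, fun w hw => isHarmonic_of_eq_harm hP (hψ.2 w (mem_words.2 hw)),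
    (hv X hX).trans (if_pos rfl), fun Y hY hne => (hv Y hY).trans (if_neg hne)⟩

lemma IsSpline.isPiecewiseHarmonic (hP : AffineIndependent ℝ P) {m : ℕ} {X : E3} {ψ : E3 → ℝ}
    (h : IsSpline P m X ψ) : IsPiecewiseHarmonic P m ψ :=
  ⟨h.1, fun w hw _ hx => eq_harm_of_isHarmonic hP (h.2.1 w (mem_words.1 hw)) hx⟩

lemma IsSpline.sum_mul {m : ℕ} {X : E3} {ψ : E3 → ℝ} (h : IsSpline P m X ψ) (hX : X ∈ V P m)
    (k : E3 → ℝ) : ∑ Y ∈ V P m, ψ Y * k Y = k X := by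
  rw [Finset.sum_eq_single X, h.2.2.1, one_mul]
  · intro Y hY hne
    rw [h.2.2.2 Y hY hne, zero_mul]
  · exact fun h' => absurd hX h'

lemma riemannSum_eq (m : ℕ) (F : E3 → ℝ) :
    riemannSum P m F = (1 / 4) ^ m * (1 / 4) * ∑ X ∈ V P m, multiplicity P m X * F X := by
  rw [riemannSum, ← Finset.mul_sum, sum_words_corners, mul_assoc]

/-- The only vertices that are not counted twice lie in `V_0`, where `F` is zero. -/
lemma riemannSum_eq_of_vanishing (hP : AffineIndependent ℝ P) (m : ℕ) {F : E3 → ℝ}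
    (hF : ∀ X ∈ V P 0, F X = 0) :
    riemannSum P m F = (1 / 4) ^ m * (1 / 2) * ∑ X ∈ V P m, F X := by
  have h : ∀ X ∈ V P m, multiplicity P m X * F X = 2 * F X := fun X hX => by
    by_cases h0 : X ∈ V P 0
    · rw [hF X h0, mul_zero, mul_zero]
    · rw [multiplicity_eq_two hP hX h0]
  rw [riemannSum_eq, Finset.sum_congr rfl h, ← Finset.mul_sum]
  ring

lemma IsSpline.integral (hP : AffineIndependent ℝ P) {m : ℕ} {X : E3} {ψ : E3 → ℝ}
    (h : IsSpline P m X ψ) (hX : X ∈ V P m) (h0 : X ∉ V P 0) :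
    ∫ x in ST P, ψ x ∂(mu P) = (1 / 4) ^ m * (1 / 2) := by
  have hs := h.sum_mul hX fun _ => 1
  simp only [mul_one] at hs
  rw [integral_ST h.1, avg_piecewiseHarmonic hP (h.isPiecewiseHarmonic hP),
    riemannSum_eq_of_vanishing hP, hs, mul_one]
  exact fun Y hY => h.2.2.2 Y (V_zero_subset m hY) fun hYX => h0 (hYX ▸ hY)

lemma IsSpline.mem_domE₀ (hP : AffineIndependent ℝ P) {m : ℕ} {X : E3} {ψ : E3 → ℝ}
    (h : IsSpline P m X ψ) (h0 : X ∉ V P 0) : ψ ∈ domE₀ P :=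
  ⟨piecewiseHarmonic_mem_domE hP (h.isPiecewiseHarmonic hP),
    fun Y hY => h.2.2.2 Y (V_zero_subset m hY) fun hYX => h0 (hYX ▸ hY)⟩

lemma renormLaplacian_eq (hP : AffineIndependent ℝ P) {ψ : ℕ → E3 → E3 → ℝ} {m : ℕ} {X : E3}
    (h : IsSpline P m X (ψ m X)) (hX : X ∈ V P m) (h0 : X ∉ V P 0) (u : E3 → ℝ) :
    renormLaplacian P ψ u m X = 2 * (6 ^ m * graphLaplacian P m u X) := by
  -- `6 = (3/2) * 4`: the energy scaling times the measure scaling.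
  have h6 : (6 : ℝ) ^ m = (r ^ m)⁻¹ * ((1 / 4) ^ m)⁻¹ := by
    rw [← mul_inv, ← mul_pow, ← inv_pow]
    norm_num [r]
  rw [renormLaplacian, h.integral hP hX h0, h6, mul_inv]
  ring

/-- The mean of a continuous function against a spline is close to its value at the vertex. -/
lemma IsSpline.abs_avg_mul_sub_le (hP : AffineIndependent ℝ P) {m : ℕ} {X : E3} {ψ g : E3 → ℝ}
    (h : IsSpline P m X ψ) (hg : ContinuousOn g (ST P)) {ε : ℝ}
    (hosc : ∀ w ∈ words m, ∀ x ∈ ST P, ∀ y ∈ ST P, |g (fw P w x) - g (fw P w y)| ≤ ε) :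
    |avg P (fun x => ψ x * g x) - avg P ψ * g X| ≤ ε * avg P ψ := by
  have hψ := h.isPiecewiseHarmonic hP
  have hb : ∀ w ∈ words m, ∀ i, 0 ≤ corners P w ψ i ∧ (corners P w ψ i ≠ 0 → fw P w (P i) = X) := by
    intro w hw i
    by_cases hX : fw P w (P i) = X
    · exact ⟨by rw [corners, hX, h.2.2.1]; exact zero_le_one, fun _ => hX⟩
    · have h0 : corners P w ψ i = 0 := h.2.2.2 _ (fw_vertex_mem_V hw i) hX
      exact ⟨h0.ge, fun hne => absurd h0 hne⟩
  have key : ∀ x ∈ ST P, 0 ≤ ψ x ∧ |ψ x * g x - ψ x * g X| ≤ ε * ψ x := by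
    have hcell : ∀ w ∈ words m, ∀ x ∈ ST P, 0 ≤ ψ (fw P w x) ∧
        |ψ (fw P w x) * g (fw P w x) - ψ (fw P w x) * g X| ≤ ε * ψ (fw P w x) := by
      intro w hw x hx
      obtain ⟨B, hB⟩ := (Set.finite_range (corners P w ψ)).bddAbove
      have hnn : 0 ≤ ψ (fw P w x) := by
        rw [hψ.2 w hw x hx]
        exact (harm_bounds hP (fun k => ⟨(hb w hw k).1, hB ⟨k, rfl⟩⟩) hx).1
      refine ⟨hnn, ?_⟩
      -- Either `X` is a corner of the cell and the oscillation bound applies, or `ψ` vanishes at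
      -- all corners and hence on the whole cell.
      by_cases hz : ∃ i, corners P w ψ i ≠ 0
      · obtain ⟨i, hi⟩ := hz
        rw [← mul_sub, abs_mul, abs_of_nonneg hnn, mul_comm ε, ← (hb w hw i).2 hi]
        exact mul_le_mul_of_nonneg_left (hosc w hw x hx _ (vertex_mem i)) hnn
      · push Not at hz
        have h0 : ψ (fw P w x) = 0 := by
          rw [hψ.2 w hw x hx]
          have := harm_bounds hP (lo := 0) (hi := 0) (fun k => ⟨(hz k).ge, (hz k).le⟩) hx
          exact le_antisymm this.2 this.1
        simp [h0]
    intro x hx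
    have hcov : ∀ m, ∀ x ∈ ST P, ∃ w ∈ words m, ∃ y ∈ ST P, fw P w y = x := by
      intro m
      induction m with
      | zero => exact fun x hx => ⟨[], by simp [words], x, hx, rfl⟩
      | succ m ih =>
        rintro _ ⟨ω, rfl⟩
        obtain ⟨w, hw, y, hy, hxy⟩ := ih _ (code_mem (P := P) (shift ω))
        refine ⟨ω 0 :: w, by simpa [mem_words] using hw, y, hy, ?_⟩
        rw [code_eq, ← hxy]
        rfl
    obtain ⟨w, hw, y, hy, rfl⟩ := hcov m x hx
    exact hcell w hw y hy
  have hi1 := integrable_code (continuous_comp_code h.1)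
  have hi2 : Integrable (fun ω => ψ (code P ω) * g (code P ω)) bernoulli :=
    integrable_code (continuous_comp_code (h.1.mul hg))
  have h1 : avg P (fun x => ψ x * g x) - avg P ψ * g X =
      ∫ ω, (ψ (code P ω) * g (code P ω) - ψ (code P ω) * g X) ∂bernoulli := by
    rw [integral_sub hi2 (hi1.mul_const _), integral_mul_const]
    rfl
  have h2 : ε * avg P ψ = ∫ ω, ε * ψ (code P ω) ∂bernoulli := (integral_const_mul _ _).symm
  rw [h1, h2, ← Real.norm_eq_abs]
  exact norm_integral_le_of_norm_le (hi1.const_mul ε)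
    (Eventually.of_forall fun ω => (key _ (code_mem ω)).2)

/-! ### The pointwise formula for the Laplacian -/

/-- The energies against a spline are constant from level `m` on, and Green's formula at that level
leaves only the term at `X`. -/
lemma avg_spline_mul (hP : AffineIndependent ℝ P) {u g : E3 → ℝ} (hu : IsLaplacian P u g)
    {m : ℕ} {X : E3} {ψ : E3 → ℝ} (h : IsSpline P m X ψ) (hX : X ∈ V P m) (h0 : X ∉ V P 0) :
    avg P (fun x => ψ x * g x) = (r ^ m)⁻¹ * graphLaplacian P m u X := by
  have h1 := hu.2.2 ψ (h.mem_domE₀ hP h0)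
  have h2 : Tendsto (fun k => energy P k u ψ) atTop (𝓝 (energy P m u ψ)) :=
    tendsto_atTop_of_eventually_const (i₀ := m) fun k hk => by
      obtain ⟨l, rfl⟩ := Nat.exists_eq_add_of_le hk
      rw [energy_comm, energy_piecewiseHarmonic hP (h.isPiecewiseHarmonic hP), energy_comm]
  have h3 := tendsto_nhds_unique h1 h2
  rw [energy_green hP, h.sum_mul hX, neg_inj] at h3
  exact (integral_ST (h.1.mul hu.2.1)).symm.trans h3

lemma uniformLimit_of_isLaplacian (hP : AffineIndependent ℝ P) {ψ : ℕ → E3 → E3 → ℝ}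
    (hψ : ∀ m, ∀ X ∈ V P m, X ∉ V P 0 → IsSpline P m X (ψ m X)) {u g : E3 → ℝ}
    (hu : IsLaplacian P u g) : UniformLimit P (renormLaplacian P ψ u) g := by
  intro ε hε
  obtain ⟨N, hN⟩ := osc_cells hu.2.1 (half_pos hε)
  refine ⟨N, fun m hm X hX h0 => lt_of_le_of_lt ?_ (half_lt_self hε)⟩
  have h := hψ m X hX h0
  have hI : ∫ x in ST P, ψ m X x ∂(mu P) = avg P (ψ m X) := integral_ST h.1
  have hpos : 0 < avg P (ψ m X) := by
    rw [← hI, h.integral hP hX h0]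
    positivity
  have h1 := h.abs_avg_mul_sub_le hP hu.2.1 fun w hw x hx y hy => (hN m hm w hw x hx y hy).le
  rw [avg_spline_mul hP hu h hX h0] at h1
  have h2 : renormLaplacian P ψ u m X - g X = (avg P (ψ m X))⁻¹ *
      ((r ^ m)⁻¹ * graphLaplacian P m u X - avg P (ψ m X) * g X) := by
    rw [renormLaplacian, hI]
    field_simp
  rw [h2, abs_mul, abs_of_pos (inv_pos.2 hpos), inv_mul_le_iff₀ hpos, mul_comm _ (ε / 2)]
  exact h1

lemma tendsto_energy_of_uniformLimit (hP : AffineIndependent ℝ P) {ψ : ℕ → E3 → E3 → ℝ}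
    (hψ : ∀ m, ∀ X ∈ V P m, X ∉ V P 0 → IsSpline P m X (ψ m X)) {u g v : E3 → ℝ}
    (hg : ContinuousOn g (ST P)) (hu : UniformLimit P (renormLaplacian P ψ u) g)
    (hv : ContinuousOn v (ST P)) (hv0 : ∀ X ∈ V P 0, v X = 0) :
    Tendsto (fun m => energy P m u v) atTop (𝓝 (-avg P fun x => v x * g x)) := by
  -- The factor `∫ ψ = 4^{-m}/2` is exactly the weight of an inner vertex in `riemannSum`.
  have hE : ∀ m, energy P m u v = -riemannSum P m fun X => v X * renormLaplacian P ψ u m X := by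
    intro m
    rw [energy_green hP, riemannSum_eq_of_vanishing hP m fun X hX => by rw [hv0 X hX, zero_mul],
      Finset.mul_sum, Finset.mul_sum, neg_inj]
    refine Finset.sum_congr rfl fun X hX => ?_
    by_cases h0 : X ∈ V P 0
    · simp [hv0 X h0]
    · have h := hψ m X hX h0
      rw [renormLaplacian, h.integral hP hX h0]
      field_simp
  obtain ⟨C, hC⟩ := (isCompact_ST P).exists_bound_of_continuousOn hv
  have hC0 : 0 ≤ C := (norm_nonneg _).trans (hC _ (vertex_mem 0))
  have hdiff : Tendsto (fun m => riemannSum P m (fun X => v X * renormLaplacian P ψ u m X) -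
      riemannSum P m fun X => v X * g X) atTop (𝓝 0) := by
    rw [Metric.tendsto_atTop]
    intro ε hε
    -- Dividing by `C + 1` also covers `C = 0`.
    obtain ⟨N, hN⟩ := hu (ε / (C + 1)) (by positivity)
    refine ⟨N, fun m hm => ?_⟩
    rw [Real.dist_0_eq_abs, ← riemannSum_sub]
    have hlt : C * (ε / (C + 1)) < ε := by
      rw [mul_div_assoc', div_lt_iff₀ (by positivity)]
      nlinarith
    refine lt_of_le_of_lt (abs_riemannSum_le m fun X hX => ?_) hlt
    rw [Pi.sub_apply, ← mul_sub, abs_mul]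
    by_cases h0 : X ∈ V P 0
    · rw [hv0 X h0, abs_zero, zero_mul]
      positivity
    · exact mul_le_mul (hC X (mem_ST_of_mem_V hX)) (hN m hm X hX h0).le (abs_nonneg _) hC0
  simp only [hE]
  have h : Tendsto (fun m => riemannSum P m fun X => v X * g X) atTop
      (𝓝 (avg P fun x => v x * g x)) := tendsto_riemannSum (hv.mul hg)
  refine Tendsto.neg ?_
  simpa only [sub_add_cancel, zero_add] using hdiff.add h

lemma isLaplacian_of_uniformLimit (hP : AffineIndependent ℝ P) {ψ : ℕ → E3 → E3 → ℝ}
    (hψ : ∀ m, ∀ X ∈ V P m, X ∉ V P 0 → IsSpline P m X (ψ m X)) {u g : E3 → ℝ}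
    (huc : ContinuousOn u (ST P)) (hg : ContinuousOn g (ST P))
    (hu : UniformLimit P (renormLaplacian P ψ u) g) : IsLaplacian P u g := by
  set a : Fin 4 → ℝ := fun i => u (P i) with ha
  have hv0 : ∀ X ∈ V P 0, (u - harm P a) X = 0 := fun X hX => by
    obtain ⟨i, rfl⟩ := mem_V_zero.1 hX
    simp [harm_vertex hP, ha]
  have h1 := tendsto_energy_of_uniformLimit hP hψ hg hu (huc.sub (continuousOn_harm hP a)) hv0
  -- The energy of `u` differs from its pairing with a function vanishing on `V_0` by a constant
  -- independent of `m`, so it converges too.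
  have h2 : ∀ m, energy P m u u = energy P m u (u - harm P a) + Q a a := fun m => by
    rw [energy_sub_right, energy_comm m u (harm P a), energy_harm hP]
    ring
  refine ⟨⟨huc, _, (h1.add_const _).congr fun m => (h2 m).symm⟩, hg, fun v hv => ?_⟩
  have hI : ∫ x in ST P, v x * g x ∂(mu P) = avg P fun x => v x * g x :=
    integral_ST (hv.1.1.mul hg)
  rw [hI]
  exact tendsto_energy_of_uniformLimit hP hψ hg hu hv.1.1 hv.2

end SierpinskiTetrahedron

open SierpinskiTetrahedron in
theorem mainTheorem3 (P : Fin 4 → E3) (hP : AffineIndependent ℝ P) :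
    (∀ m, ∀ X ∈ V P m, X ∉ V P 0 → ∃ ψ, IsSpline P m X ψ) ∧
    ∀ ψ : ℕ → E3 → E3 → ℝ, (∀ m, ∀ X ∈ V P m, X ∉ V P 0 → IsSpline P m X (ψ m X)) →
      (∀ u Δu : E3 → ℝ, IsLaplacian P u Δu →
        UniformLimit P (renormLaplacian P ψ u) Δu ∧
        ∀ k, ∀ X ∈ V P k, X ∉ V P 0 →
          Tendsto (fun m => 2 * (6 ^ m * graphLaplacian P m u X)) atTop (𝓝 (Δu X))) ∧
      (∀ u g : E3 → ℝ, ContinuousOn u (ST P) → ContinuousOn g (ST P) →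
        UniformLimit P (renormLaplacian P ψ u) g → u ∈ domLaplacian P) := by
  refine ⟨fun m X hX _ => exists_isSpline hP m hX, fun ψ hψ => ⟨fun u g hu => ?_,
    fun u g hu hg hlim => ⟨g, isLaplacian_of_uniformLimit hP hψ hu hg hlim⟩⟩⟩
  have hlim := uniformLimit_of_isLaplacian hP hψ hu
  refine ⟨hlim, fun k X hX h0 => ?_⟩
  rw [Metric.tendsto_atTop]
  intro ε hε
  obtain ⟨N, hN⟩ := hlim ε hε
  refine ⟨max N k, fun m hm => ?_⟩
  have hXm := V_mono (le_of_max_le_right hm) hX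
  rw [Real.dist_eq, ← renormLaplacian_eq hP (hψ m X hXm h0) hXm h0]
  exact hN m (le_of_max_le_left hm) X hXm h0
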